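/- **Setting.** Let $\gamma>1$ and $\mu,\kappa,R>0$. For a state $\mathbf U=(\rho,\rho\vec u,E)\in\mathbb R^5$ with $p=(\gamma-1)(E-\tfrac12\rho|\vec u|^2)$, $\rho>0$, $p>0$, put $\varsigma=\log(p\rho^{-\gamma})$, $s=-\rho\varsigma/(\gamma-1)$, and let $\mathbf W=\partial s/\partial \mathbf U=\big[\tfrac{\gamma-\varsigma}{\gamma-1}-\tfrac{\rho}{2p}|\vec u|^2,\ \tfrac{\rho\vec u}{p},\ -\tfrac{\rho}{p}\big]^T$ be the entropy variables. Let $\mathbf F_\iota$ ($\iota=1,2,3$) be the Euler fluxes and $\mathsf B^{\rm v}(\mathbf W)$ the viscous block matrix, i.e. the compressible Navier–Stokes viscous flux (viscosity $\mu$, Stokes' hypothesis, heat flux $-\kappa\nabla T$, $T=p/(R\rho)$) equals $\mathsf B^{\rm v}(\mathbf W)\vec\nabla_x\mathbf W$. On $E=[-1,1]^3$ use the tensor product Legendre–Gauss–Lobatto (LGL) nodes with $N+1\ge 2$ points per direction, $\langle\cdot,\cdot\rangle_N$ the LGL inner product, $\int_{\partial E,N}$ the LGL surface quadrature, $\mathcal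 D$ the derivative matrix and $I_N$ the interpolation operator. Consider $K$ moving elements on $[0,T]$, $T>0$, with degree-$N$ mappings $\vec\chi$, grid velocity $\vec\nu=\partial_\tau\vec\chi$, and contravariant vectors $\mathbb J\vec a^\iota$ computed at the nodes in conservative curl form, $\mathbb Ja^\iota_\beta=-\big(\nabla_\xi\times I_N(\chi_l\nabla_\xi\chi_m)\big)_\iota$, $(\beta,m,l)$ cyclic. Put $\hat s\vec n=\sum_\iota\mathbb J\vec a^\iota\hat n^\iota$ with $|\vec n|=1$ (and $\hat s\ge0$); for a vector or a block vector a subscript $\hat n$ denotes $\hat s\vec n\,\cdot$ of it. Let $\mathsf M^T$ be the map from a block vector $\mathbf f=(\mathbf f_1,\mathbf f_2,\mathbf f_3)$ to its contravariant components $\sum_\beta \mathbb Ja^\iota_\beta\mathbf f_\beta$, and $\tilde{\mathsf B}^{\rm v}=\mathsf M^T\mathsf B^{\rm v}$. At element boundaries the superscript $-$ (or none) denotes interior values and $+$ exterior ones (from the neighbour, or prescribed by boundary conditions), $[\![a]\!]=a^+-a^-$, $\{\!\{a\}\!\}=\frac12(a^++a^-)$; the average $\{\!\{\tilde{\mathsf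 B}^{\rm v}\mathbf Q\}\!\}\cdot\hat n$ means $\hat s\vec n\cdot\{\!\{\mathsf B^{\rm v}\mathbf Q\}\!\}$. For a pair of nodes in the volume, $[\![a]\!]$ is the difference and $\{\!\{a\}\!\}$ the mean of the two nodal values. The split form ALE DGSEM with BR1 viscous terms determines $\mathcal J,\mathbf U,\mathbf Q$ (with $\mathbf W=\mathbf W(\mathbf U)$ at the nodes) by $$\langle\partial_\tau\mathcal J,\varphi\rangle_N=\langle \mathbb D\cdot\tilde\nu^\#,\varphi\rangle_N+\int_{\partial E,N}\varphi(\tilde\nu^*_{\hat n}-\tilde\nu_{\hat n})\,dS,$$ $$\langle\partial_\tau(\mathcal J\mathbf U),\boldsymbol\varphi\rangle_N=-\langle\mathbb D\cdot\tilde{\mathbf G}^\#,\boldsymbol\varphi\rangle_N-\int_{\partial E,N}\boldsymbol\varphi^T(\tilde{\mathbf G}^*_{\hat n}-\tilde{\mathbf G}_{\hat n})\,dS+\langle\nabla_\xi\cdot I_N(\tilde{\mathsf B}^{\rm v}\mathbf Q),\boldsymbol\varphi\rangle_N+\int_{\partial E,N}\boldsymbol\varphi^T\{[\{\!\{\tilde{\mathsf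 B}^{\rm v}\mathbf Q\}\!\}-\tilde{\mathsf B}^{\rm v}\mathbf Q]\cdot\hat n\}\,dS,$$ $$\langle\mathcal J\mathbf Q,\boldsymbol\varphi\rangle_N=\langle\nabla_\xi I_N(\mathbf W),\mathsf M^T\boldsymbol\varphi\rangle_N+\int_{\partial E,N}(\{\!\{\mathbf W\}\!\}-\mathbf W)^T\{\mathsf M^T\boldsymbol\varphi\cdot\hat n\}\,dS$$ for all scalar, state-valued and block-valued test polynomials of degree $N$, respectively. Here $\mathbf G_\iota=\mathbf F_\iota(\mathbf U)-\nu_\iota\mathbf U$, $\tilde\nu^*_{\hat n}=\hat s\vec n\cdot\{\!\{\vec\nu\}\!\}$, $\tilde{\mathbf G}^*_{\hat n}=\hat s\sum_\iota n_\iota\mathbf G^*_\iota$ with numerical surface fluxes $\mathbf G^*_\iota$ that may depend on $\vec n$. In the volume, $(\mathbb D\cdot\tilde\nu^\#)_{ijk}$ is the sum over the three directions of $\sum_m2\mathcal D_{im}\{\!\{\vec\nu\}\!\}\cdot\{\!\{\mathbb J\vec a^1\}\!\}$ (written for direction 1, at the nodes $ijk$ and $mjk$), and $\mathbb D\cdot\tilde{\mathbf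 G}^\#$ is the same with $\{\!\{\vec\nu\}\!\}$ replaced by a two-point volume flux $\mathbf G^\#(\vec\nu_1,\vec\nu_2,\mathbf U_1,\mathbf U_2)$ which is symmetric under exchange of the two nodes and consistent, $\mathbf G_\iota^\#(\vec\nu_1,\vec\nu_2,\mathbf U,\mathbf U)=\mathbf F_\iota(\mathbf U)-\{\!\{\nu_\iota\}\!\}\mathbf U$. **Theorem.** Let $\mathcal J,\mathbf U,\mathbf Q$ solve the scheme on $[0,T]$, with $\mathcal J$ and $\mathcal J\mathbf U$ differentiable in time and $\mathcal J>0$, $\rho>0$, $p>0$ at all nodes. Suppose that for all pairs of LGL nodes on a common grid line of an element $$[\![\mathbf W]\!]^T\mathbf G^\#_\iota=[\![\rho u_\iota]\!]-\{\!\{\nu_\iota\}\!\}[\![\rho]\!],\qquad\iota=1,2,3 .$$ (a) On each element and for all $\tau\in[0,T]$ the discrete entropy $\langle I_N(s),\mathcal J\rangle_N$ is differentiable in $\tau$ and $$\frac{d}{d\tau}\langle I_N(s),\mathcal J\rangle_N\le-\int_{\partial E,N}\big(\mathbf W^T\tilde{\mathbf G}^*_{\hat n}-\rho[\tilde u_{\hat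 n}-\tilde\nu^*_{\hat n}]\big)dS+\int_{\partial E,N}\mathbf W^T\{[\{\!\{\tilde{\mathsf B}^{\rm v}(\mathbf W)\mathbf Q\}\!\}-\tilde{\mathsf B}^{\rm v}(\mathbf W)\mathbf Q]\cdot\hat n\}\,dS+\int_{\partial E,N}\{\!\{\mathbf W\}\!\}^T\{(\tilde{\mathsf B}^{\rm v}(\mathbf W)\mathbf Q)\cdot\hat n\}\,dS .$$ (b) Suppose in addition that the mesh is closed periodically (the boundary nodes of the elements are matched in pairs with equal quadrature weights and opposite scaled normals $\hat s\vec n$, and the exterior values at a node are the interior values at its partner), that the two sides of an interface use the same fluxes $\mathbf G^*_\iota$, and that these are entropy stable: at every boundary node, with $\vec n$ pointing from the $-$ to the $+$ side, $$\sum_{\iota=1}^3n_\iota\,[\![\mathbf W]\!]^T\mathbf G^*_\iota\le\sum_{\iota=1}^3n_\iota\big([\![\rho u_\iota]\!]-\{\!\{\nu_\iota\}\!\}[\![\rho]\!]\big).$$ Then the total discrete entropy $\mathbb S(\tau)=\sum_{k=1}^K\langle I_N(s),\mathcal J\rangle_N$ satisfies $\frac{d\mathbb S}{d\tau}\le0$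 on $[0,T]$; in particular $\mathbb S$ is non-increasing. -/

import Mathlib

open Set

noncomputable section

namespace ALEDG

/-! ### Gas dynamics -/

/-- Vectors in physical space, conserved (or entropy) variables, and block vectors
(three state vectors, one for each Cartesian direction). -/
abbrev Vec := Fin 3 → ℝ
abbrev State := Fin 5 → ℝ
abbrev Block := Fin 3 → Fin 5 → ℝ

/-- The constants of the gas: adiabatic exponent, dynamic viscosity, thermal conductivity and
gas constant. -/
structure Gas where
  γ : ℝ
  μ : ℝ
  κ : ℝ
  R : ℝ
  one_lt_γ : 1 < γ
  μ_pos : 0 < μ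
  κ_pos : 0 < κ
  R_pos : 0 < R

/-- The position of the `i`-th momentum in a state vector. -/
def mom (i : Fin 3) : Fin 5 := i.succ.castSucc

def density (U : State) : ℝ := U 0

def velocity (U : State) : Vec := fun i => U (mom i) / U 0

def pressure (gas : Gas) (U : State) : ℝ :=
  (gas.γ - 1) * (U 4 - 1 / 2 * density U * ∑ i, velocity U i ^ 2)

/-- Positive density and pressure. -/
def Admissible (gas : Gas) (U : State) : Prop := 0 < density U ∧ 0 < pressure gas U

/-- Specific internal energy. -/
def internalEnergy (gas : Gas) (U : State) : ℝ :=
  pressure gas U / ((gas.γ - 1) * density U)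

/-- The advective (Euler) flux in the `i`-th Cartesian direction. -/
def eulerFlux (gas : Gas) (U : State) : Block := fun i =>
  ![density U * velocity U i,
    density U * velocity U i * velocity U 0 + (if i = 0 then pressure gas U else 0),
    density U * velocity U i * velocity U 1 + (if i = 1 then pressure gas U else 0),
    density U * velocity U i * velocity U 2 + (if i = 2 then pressure gas U else 0),
    density U * velocity U i * (internalEnergy gas U + 1 / 2 * ∑ j, velocity U j ^ 2)
      + pressure gas U * velocity U i]

/-- Thermodynamic entropy `ς = log (p ρ ^ (-γ))`. -/
def thermoEntropy (gas : Gas) (U : State) : ℝ :=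
  Real.log (pressure gas U * density U ^ (-gas.γ))

/-- Mathematical entropy `s = - ρ ς / (γ - 1)`. -/
def entropy (gas : Gas) (U : State) : ℝ :=
  -(density U * thermoEntropy gas U) / (gas.γ - 1)

/-- The entropy variables `w = ∂s/∂u`. -/
def entropyVars (gas : Gas) (U : State) : State :=
  ![(gas.γ - thermoEntropy gas U) / (gas.γ - 1)
      - density U / (2 * pressure gas U) * ∑ i, velocity U i ^ 2,
    density U * velocity U 0 / pressure gas U,
    density U * velocity U 1 / pressure gas U,
    density U * velocity U 2 / pressure gas U,
    -(density U / pressure gas U)]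

/-- The shear stress tensor, where `gradu i j = ∂u_j/∂x_i`. -/
def stress (gas : Gas) (gradu : Fin 3 → Vec) (i j : Fin 3) : ℝ :=
  gas.μ * (gradu i j + gradu j i) - (if i = j then 2 / 3 * gas.μ * ∑ k, gradu k k else 0)

/-- The viscous flux as a function of the velocity, its gradient and the temperature gradient;
the heat flux is `q_i = - κ ∂T/∂x_i`. -/
def viscousFlux (gas : Gas) (u : Vec) (gradu : Fin 3 → Vec) (gradT : Vec) : Block := fun i =>
  ![0, stress gas gradu i 0, stress gas gradu i 1, stress gas gradu i 2,
    ∑ j, u j * stress gas gradu i j + gas.κ * gradT i]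

/-- The velocity as a function of the entropy variables. -/
def velocityOfEntropy (w : State) : Vec := fun i => -(w (mom i)) / w 4

/-- The temperature `T = p / (R ρ)` as a function of the entropy variables. -/
def temperatureOfEntropy (gas : Gas) (w : State) : ℝ := -1 / (gas.R * w 4)

/-- The directional derivative of `velocityOfEntropy` at `w` along `v`. -/
def velocityDeriv (w v : State) : Vec := fun i =>
  -(v (mom i) + velocityOfEntropy w i * v 4) / w 4

/-- The directional derivative of `temperatureOfEntropy` at `w` along `v`. -/
def temperatureDeriv (gas : Gas) (w v : State) : ℝ := v 4 / (gas.R * w 4 ^ 2)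

theorem hasDerivAt_velocityOfEntropy {f : ℝ → State} {v : State} {x : ℝ}
    (hf : HasDerivAt f v x) (h4 : f x 4 ≠ 0) :
    HasDerivAt (fun y => velocityOfEntropy (f y)) (velocityDeriv (f x) v) x := by
  rw [hasDerivAt_pi] at hf ⊢
  intro i
  have := ((hf (mom i)).fun_neg).fun_div (hf 4) h4
  refine this.congr_deriv ?_
  simp only [velocityDeriv, velocityOfEntropy]
  field_simp
  ring

theorem hasDerivAt_temperatureOfEntropy (gas : Gas) {f : ℝ → State} {v : State} {x : ℝ}
    (hf : HasDerivAt f v x) (h4 : f x 4 ≠ 0) :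
    HasDerivAt (fun y => temperatureOfEntropy gas (f y)) (temperatureDeriv gas (f x) v) x := by
  have hR := gas.R_pos.ne'
  have := (hasDerivAt_const x (-1 : ℝ)).fun_div
    (((hasDerivAt_pi.1 hf) 4).const_mul gas.R) (mul_ne_zero hR h4)
  refine this.congr_deriv ?_
  simp only [temperatureDeriv]
  field_simp
  ring

/-- The product of the viscous block matrix `B^v(w)` with a block vector `Q`: the viscous flux
written, by the chain rule, as a function of `w` and of the gradient `Q = ∇w`, in which it is
linear. Here `Q i` stands for `∂w/∂x_i`. -/
def viscousBlock (gas : Gas) (w : State) (Q : Block) : Block :=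
  viscousFlux gas (velocityOfEntropy w) (fun i => velocityDeriv w (Q i))
    (fun i => temperatureDeriv gas w (Q i))

/-! ### Legendre-Gauss-Lobatto collocation on the reference cube -/

/-- The Legendre-Gauss-Lobatto rule with `N + 1` points on `[-1, 1]`: both end points are nodes
and the rule has degree of exactness `2 N - 1`. This determines the nodes and the weights. -/
structure IsLGL (N : ℕ) (ξ ω : Fin (N + 1) → ℝ) : Prop where
  strictMono : StrictMono ξ
  left : ξ 0 = -1
  right : ξ (Fin.last N) = 1
  exact_of_natDegree_le : ∀ p : Polynomial ℝ, p.natDegree ≤ 2 * N - 1 →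
    ∫ x in (-1 : ℝ)..1, p.eval x = ∑ i, ω i * p.eval (ξ i)

/-- Multi-indices `(i, j, k)` of the tensor product nodes. An element of the polynomial space
`ℙ^N(E)` is represented by its values at these nodes. -/
abbrev Node (N : ℕ) := Fin 3 → Fin (N + 1)

variable {N : ℕ}

/-- The derivative matrix `D_{ij} = ℓ_j'(ξ_i)` of the Lagrange basis. -/
def derivMatrix (ξ : Fin (N + 1) → ℝ) (i j : Fin (N + 1)) : ℝ :=
  (Lagrange.basis Finset.univ ξ j).derivative.eval (ξ i)

/-- Nodal values of the partial derivative in direction `d` of the tensor product interpolant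
of `f`. -/
def partialDeriv (ξ : Fin (N + 1) → ℝ) (d : Fin 3) (f : Node N → ℝ) (n : Node N) : ℝ :=
  ∑ m, derivMatrix ξ (n d) m * f (Function.update n d m)

/-- The LGL quadrature on the reference cube. The discrete inner product `⟨f, g⟩_N` is
`volInt ω (fun n => f n ⬝ᵥ g n)`. -/
def volInt (ω : Fin (N + 1) → ℝ) (f : Node N → ℝ) : ℝ :=
  ∑ n : Node N, (∏ d, ω (n d)) * f n

/-- A face of the cube: the direction orthogonal to it, and whether it is the face `ξ^d = 1`
(`true`) or `ξ^d = -1` (`false`). -/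
abbrev Face := Fin 3 × Bool

/-- The index of the node `1` (`true`) or `-1` (`false`). -/
def endIndex (N : ℕ) (b : Bool) : Fin (N + 1) := if b then Fin.last N else 0

/-- The nodes on the boundary of the cube, sorted by faces: a node on an edge occurs once for
each face that contains it. -/
abbrev FaceNode (N : ℕ) := {x : Face × Node N // x.2 x.1.1 = endIndex N x.1.2}

/-- The node that underlies a face node. -/
def FaceNode.node (x : FaceNode N) : Node N := x.1.2

/-- The outward unit normal of the reference cube. -/
def refNormal (x : FaceNode N) : Vec := fun d =>
  if d = x.1.1.1 then (if x.1.1.2 then 1 else -1) else 0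

/-- The two-dimensional quadrature weight at a face node. -/
def faceWeight (ω : Fin (N + 1) → ℝ) (x : FaceNode N) : ℝ :=
  ∏ d ∈ Finset.univ.erase x.1.1.1, ω (x.node d)

/-- The discrete surface integral over the boundary of the cube; the normal is part of the
integrand. -/
def surfInt (ω : Fin (N + 1) → ℝ) (g : FaceNode N → ℝ) : ℝ :=
  ∑ x : FaceNode N, faceWeight ω x * g x

/-- The volume weighted contravariant vectors in conservative curl form,
`Ja^i_b = - (∇_ξ × I_N (χ_l ∇_ξ χ_m))_i` with `(b, m, l)` cyclic; `χ` holds the nodal positions. -/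
def contravariant (ξ : Fin (N + 1) → ℝ) (χ : Node N → Vec) (i b : Fin 3) (n : Node N) : ℝ :=
  -(partialDeriv ξ (i + 1)
        (fun p => χ p (b + 2) * partialDeriv ξ (i + 2) (fun r => χ r (b + 1)) p) n
    - partialDeriv ξ (i + 2)
        (fun p => χ p (b + 2) * partialDeriv ξ (i + 1) (fun r => χ r (b + 1)) p) n)

/-- `Mᵀ f`: the contravariant components `Ja^i · f` of a block vector. -/
def contraBlock (ξ : Fin (N + 1) → ℝ) (χ : Node N → Vec) (n : Node N) (f : Block) : Block :=
  fun i a => ∑ b, contravariant ξ χ i b n * f b a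

/-- The scaled outward normal `∑_i Ja^i n̂^i`. -/
def scaledNormal (ξ : Fin (N + 1) → ℝ) (χ : Node N → Vec) (x : FaceNode N) : Vec :=
  fun b => ∑ i, contravariant ξ χ i b x.node * refNormal x i

/-- The surface element `ŝ`, the Euclidean length of the scaled normal. -/
def surfElem (ξ : Fin (N + 1) → ℝ) (χ : Node N → Vec) (x : FaceNode N) : ℝ :=
  Real.sqrt (∑ b, scaledNormal ξ χ x b ^ 2)

/-- The outward unit normal of the physical element. -/
def unitNormal (ξ : Fin (N + 1) → ℝ) (χ : Node N → Vec) (x : FaceNode N) : Vec :=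
  fun b => (1 / surfElem ξ χ x) * scaledNormal ξ χ x b

/-- `(ŝ n) · v` for a vector `v`. -/
def normalVec (ξ : Fin (N + 1) → ℝ) (χ : Node N → Vec) (x : FaceNode N) (v : Vec) : ℝ :=
  surfElem ξ χ x * ∑ b, unitNormal ξ χ x b * v b

/-- `(ŝ n) · f` for a block vector `f`; this is `(Mᵀ f) · n̂`. -/
def normalBlock (ξ : Fin (N + 1) → ℝ) (χ : Node N → Vec) (x : FaceNode N) (f : Block) : State :=
  fun a => surfElem ξ χ x * ∑ b, unitNormal ξ χ x b * f b a

/-- Arithmetic mean. -/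
def avg {ι : Type*} (f g : ι → ℝ) : ι → ℝ := fun i => 1 / 2 * (f i + g i)

/-- Arithmetic mean of block vectors. -/
def avgBlock (f g : Block) : Block := fun i => avg (f i) (g i)

/-! ### Numerical fluxes -/

/-- Two-point volume fluxes `G^#(ν₁, ν₂, U₁, U₂)` and surface fluxes `G^*(n, ν⁻, ν⁺, U⁻, U⁺)`,
each with its three Cartesian components. The surface flux may depend on the unit normal, which
points from the `-` side to the `+` side. -/
abbrev VolumeFlux := Vec → Vec → State → State → Block
abbrev SurfaceFlux := Vec → Vec → Vec → State → State → Block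

def VolumeFlux.Consistent (gas : Gas) (G : VolumeFlux) : Prop :=
  ∀ (ν₁ ν₂ : Vec) (U : State), Admissible gas U →
    ∀ i a, G ν₁ ν₂ U U i a = eulerFlux gas U i a - avg ν₁ ν₂ i * U a

def VolumeFlux.Symmetric (gas : Gas) (G : VolumeFlux) : Prop :=
  ∀ (ν₁ ν₂ : Vec) (U₁ U₂ : State), Admissible gas U₁ → Admissible gas U₂ →
    G ν₁ ν₂ U₁ U₂ = G ν₂ ν₁ U₂ U₁

/-- The two elements at an interface use the same Cartesian fluxes. -/
def SurfaceFlux.SingleValued (gas : Gas) (G : SurfaceFlux) : Prop :=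
  ∀ (n νm νp : Vec) (Um Up : State), Admissible gas Um → Admissible gas Up →
    G (-n) νp νm Up Um = G n νm νp Um Up

/-! ### The scheme -/

/-- The unknowns of the semi-discrete scheme on `K` elements: nodal positions `χ`, grid velocity
`ν`, Jacobian `J`, conserved variables `U` and gradient variables `Q` for each element and time,
and the exterior (`+`) values of `ν`, `U`, `Q` at the boundary nodes of each element. The latter
are the values in the neighbouring element or are given by boundary conditions. -/
structure Fields (K N : ℕ) where
  χ : Fin K → ℝ → Node N → Vec
  ν : Fin K → ℝ → Node N → Vec
  J : Fin K → ℝ → Node N → ℝ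
  U : Fin K → ℝ → Node N → State
  Q : Fin K → ℝ → Node N → Block
  νExt : Fin K → ℝ → FaceNode N → Vec
  UExt : Fin K → ℝ → FaceNode N → State
  QExt : Fin K → ℝ → FaceNode N → Block

variable {K : ℕ}

namespace Fields

/-- Nodal entropy variables `W`, inside and outside. -/
def W (gas : Gas) (S : Fields K N) (α : Fin K) (τ : ℝ) (n : Node N) : State :=
  entropyVars gas (S.U α τ n)

def WExt (gas : Gas) (S : Fields K N) (α : Fin K) (τ : ℝ) (x : FaceNode N) : State :=
  entropyVars gas (S.UExt α τ x)

/-- Nodal viscous fluxes `B^v(W) Q`, inside and outside, in Cartesian components. -/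
def visc (gas : Gas) (S : Fields K N) (α : Fin K) (τ : ℝ) (n : Node N) : Block :=
  viscousBlock gas (S.W gas α τ n) (S.Q α τ n)

def viscExt (gas : Gas) (S : Fields K N) (α : Fin K) (τ : ℝ) (x : FaceNode N) : Block :=
  viscousBlock gas (S.WExt gas α τ x) (S.QExt α τ x)

/-- The derivative projection operator applied to the grid velocity. -/
def divGrid (ξ : Fin (N + 1) → ℝ) (S : Fields K N) (α : Fin K) (τ : ℝ) (n : Node N) : ℝ :=
  ∑ d, ∑ m, 2 * derivMatrix ξ (n d) m *
    ∑ b, avg (S.ν α τ n) (S.ν α τ (Function.update n d m)) b *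
      (1 / 2 * (contravariant ξ (S.χ α τ) d b n
        + contravariant ξ (S.χ α τ) d b (Function.update n d m)))

/-- The derivative projection operator applied to the volume fluxes. -/
def divVolume (ξ : Fin (N + 1) → ℝ) (G : VolumeFlux) (S : Fields K N) (α : Fin K) (τ : ℝ)
    (n : Node N) : State := fun a =>
  ∑ d, ∑ m, 2 * derivMatrix ξ (n d) m *
    ∑ b, G (S.ν α τ n) (S.ν α τ (Function.update n d m)) (S.U α τ n)
        (S.U α τ (Function.update n d m)) b a *
      (1 / 2 * (contravariant ξ (S.χ α τ) d b n
        + contravariant ξ (S.χ α τ) d b (Function.update n d m)))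

/-- The divergence `∇_ξ · I_N (B̃^v(W) Q)` with `B̃^v = Mᵀ B^v`. -/
def divVisc (ξ : Fin (N + 1) → ℝ) (gas : Gas) (S : Fields K N) (α : Fin K) (τ : ℝ)
    (n : Node N) : State := fun a =>
  ∑ d, partialDeriv ξ d (fun p => contraBlock ξ (S.χ α τ) p (S.visc gas α τ p) d a) n

/-- `∇_ξ I_N (W)`. -/
def gradW (ξ : Fin (N + 1) → ℝ) (gas : Gas) (S : Fields K N) (α : Fin K) (τ : ℝ)
    (n : Node N) : Block := fun d a =>
  partialDeriv ξ d (fun p => S.W gas α τ p a) n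

/-- Normal grid velocity, its numerical surface flux, and the normal fluid velocity. -/
def gridNormal (ξ : Fin (N + 1) → ℝ) (S : Fields K N) (α : Fin K) (τ : ℝ) (x : FaceNode N) : ℝ :=
  normalVec ξ (S.χ α τ) x (S.ν α τ x.node)

def gridNormalStar (ξ : Fin (N + 1) → ℝ) (S : Fields K N) (α : Fin K) (τ : ℝ)
    (x : FaceNode N) : ℝ :=
  normalVec ξ (S.χ α τ) x (avg (S.ν α τ x.node) (S.νExt α τ x))

def fluidNormal (ξ : Fin (N + 1) → ℝ) (S : Fields K N) (α : Fin K) (τ : ℝ) (x : FaceNode N) : ℝ :=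
  normalVec ξ (S.χ α τ) x (velocity (S.U α τ x.node))

/-- The normal component of `G_i = F_i(U) - ν_i U`. -/
def fluxNormal (ξ : Fin (N + 1) → ℝ) (gas : Gas) (S : Fields K N) (α : Fin K) (τ : ℝ)
    (x : FaceNode N) : State :=
  normalBlock ξ (S.χ α τ) x
    (fun i a => eulerFlux gas (S.U α τ x.node) i a - S.ν α τ x.node i * S.U α τ x.node a)

/-- The Cartesian surface fluxes `G_i^*` at a boundary node. -/
def surfaceFluxAt (ξ : Fin (N + 1) → ℝ) (Gs : SurfaceFlux) (S : Fields K N) (α : Fin K) (τ : ℝ)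
    (x : FaceNode N) : Block :=
  Gs (unitNormal ξ (S.χ α τ) x) (S.ν α τ x.node) (S.νExt α τ x) (S.U α τ x.node) (S.UExt α τ x)

/-- The contravariant numerical surface flux `ŝ (n₁ G₁^* + n₂ G₂^* + n₃ G₃^*)`. -/
def fluxNormalStar (ξ : Fin (N + 1) → ℝ) (Gs : SurfaceFlux) (S : Fields K N) (α : Fin K) (τ : ℝ)
    (x : FaceNode N) : State :=
  normalBlock ξ (S.χ α τ) x (S.surfaceFluxAt ξ Gs α τ x)

/-- The interior viscous flux through the boundary, `(B̃^v(W) Q) · n̂`. -/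
def viscNormal (ξ : Fin (N + 1) → ℝ) (gas : Gas) (S : Fields K N) (α : Fin K) (τ : ℝ)
    (x : FaceNode N) : State :=
  normalBlock ξ (S.χ α τ) x (S.visc gas α τ x.node)

/-- The BR1 viscous flux through the boundary, `⦃B̃^v(W) Q⦄ · n̂`; both one-sided values are
taken with respect to the same normal. -/
def viscNormalAvg (ξ : Fin (N + 1) → ℝ) (gas : Gas) (S : Fields K N) (α : Fin K) (τ : ℝ)
    (x : FaceNode N) : State :=
  normalBlock ξ (S.χ α τ) x (avgBlock (S.visc gas α τ x.node) (S.viscExt gas α τ x))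

/-- The average of the entropy variables at the boundary. -/
def WAvg (gas : Gas) (S : Fields K N) (α : Fin K) (τ : ℝ) (x : FaceNode N) : State :=
  avg (S.W gas α τ x.node) (S.WExt gas α τ x)

/-- The split form ALE DGSEM for the Navier-Stokes equations, with BR1 viscous terms in the
entropy variables, on the time interval `[0, T]`. -/
structure SolvesScheme (gas : Gas) (ξ ω : Fin (N + 1) → ℝ) (Gv : VolumeFlux) (Gs : SurfaceFlux)
    (T : ℝ) (S : Fields K N) : Prop where
  grid_velocity : ∀ α, ∀ τ ∈ Icc 0 T, ∀ n,
    HasDerivWithinAt (fun t => S.χ α t n) (S.ν α τ n) (Icc 0 T) τ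
  J_pos : ∀ α, ∀ τ ∈ Icc 0 T, ∀ n, 0 < S.J α τ n
  admissible : ∀ α, ∀ τ ∈ Icc 0 T, ∀ n, Admissible gas (S.U α τ n)
  J_diff : ∀ α, ∀ τ ∈ Icc 0 T, ∀ n,
    DifferentiableWithinAt ℝ (fun t => S.J α t n) (Icc 0 T) τ
  JU_diff : ∀ α, ∀ τ ∈ Icc 0 T, ∀ n,
    DifferentiableWithinAt ℝ (fun t => S.J α t n • S.U α t n) (Icc 0 T) τ
  /-- Discrete geometric conservation law. -/
  gcl : ∀ α, ∀ τ ∈ Icc 0 T, ∀ φ : Node N → ℝ,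
    volInt ω (fun n => derivWithin (fun t => S.J α t n) (Icc 0 T) τ * φ n)
      = volInt ω (fun n => S.divGrid ξ α τ n * φ n)
        + surfInt ω (fun x => φ x.node * (S.gridNormalStar ξ α τ x - S.gridNormal ξ α τ x))
  /-- Balance of mass, momentum and energy. -/
  balance : ∀ α, ∀ τ ∈ Icc 0 T, ∀ φ : Node N → State,
    volInt ω (fun n => derivWithin (fun t => S.J α t n • S.U α t n) (Icc 0 T) τ ⬝ᵥ φ n)
      = -volInt ω (fun n => S.divVolume ξ Gv α τ n ⬝ᵥ φ n)
        - surfInt ω (fun x =>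
            φ x.node ⬝ᵥ (S.fluxNormalStar ξ Gs α τ x - S.fluxNormal ξ gas α τ x))
        + volInt ω (fun n => S.divVisc ξ gas α τ n ⬝ᵥ φ n)
        + surfInt ω (fun x =>
            φ x.node ⬝ᵥ (S.viscNormalAvg ξ gas α τ x - S.viscNormal ξ gas α τ x))
  /-- The gradient of the entropy variables. -/
  gradient : ∀ α, ∀ τ ∈ Icc 0 T, ∀ φ : Node N → Block,
    volInt ω (fun n => ∑ b, (S.J α τ n • S.Q α τ n b) ⬝ᵥ φ n b)
      = volInt ω (fun n => ∑ d, S.gradW ξ gas α τ n d ⬝ᵥ contraBlock ξ (S.χ α τ) n (φ n) d)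
        + surfInt ω (fun x => (S.WAvg gas α τ x - S.W gas α τ x.node) ⬝ᵥ
            ∑ d, refNormal x d • contraBlock ξ (S.χ α τ) x.node (φ x.node) d)

/-- Tadmor's entropy conservation condition on a moving mesh for the volume fluxes, at all pairs
of LGL points on a common grid line of an element. -/
def VolumeEntropyConservative (gas : Gas) (Gv : VolumeFlux) (T : ℝ) (S : Fields K N) : Prop :=
  ∀ α, ∀ τ ∈ Icc 0 T, ∀ (n : Node N) (d : Fin 3) (m : Fin (N + 1)) (i : Fin 3),
    let n' := Function.update n d m
    let U₁ := S.U α τ n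
    let U₂ := S.U α τ n'
    (S.W gas α τ n - S.W gas α τ n') ⬝ᵥ Gv (S.ν α τ n) (S.ν α τ n') U₁ U₂ i
      = (density U₁ * velocity U₁ i - density U₂ * velocity U₂ i)
        - avg (S.ν α τ n) (S.ν α τ n') i * (density U₁ - density U₂)

/-- The entropy stability condition for the surface fluxes at all boundary nodes, in the direction
of the normal `n`, which points from the `-` (interior) to the `+` (exterior) side. -/
def SurfaceEntropyStable (gas : Gas) (ξ : Fin (N + 1) → ℝ) (Gs : SurfaceFlux) (T : ℝ)
    (S : Fields K N) : Prop :=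
  ∀ α, ∀ τ ∈ Icc 0 T, ∀ x : FaceNode N,
    let Um := S.U α τ x.node
    let Up := S.UExt α τ x
    ∑ i, unitNormal ξ (S.χ α τ) x i *
        ((S.WExt gas α τ x - S.W gas α τ x.node) ⬝ᵥ S.surfaceFluxAt ξ Gs α τ x i)
      ≤ ∑ i, unitNormal ξ (S.χ α τ) x i *
        ((density Up * velocity Up i - density Um * velocity Um i)
          - avg (S.ν α τ x.node) (S.νExt α τ x) i * (density Up - density Um))

/-- The mesh closes up periodically: `nbr` matches the boundary nodes of the elements in pairs.
Matched nodes have the same quadrature weight and opposite scaled normals, and the exterior values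
of one are the interior values of the other. -/
structure Periodic (ξ ω : Fin (N + 1) → ℝ) (T : ℝ) (S : Fields K N)
    (nbr : Fin K × FaceNode N → Fin K × FaceNode N) : Prop where
  involutive : Function.Involutive nbr
  weight : ∀ y, faceWeight ω (nbr y).2 = faceWeight ω y.2
  normal : ∀ τ ∈ Icc 0 T, ∀ y,
    scaledNormal ξ (S.χ (nbr y).1 τ) (nbr y).2 = -scaledNormal ξ (S.χ y.1 τ) y.2
  ν_ext : ∀ τ ∈ Icc 0 T, ∀ y, S.νExt y.1 τ y.2 = S.ν (nbr y).1 τ (nbr y).2.node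
  U_ext : ∀ τ ∈ Icc 0 T, ∀ y, S.UExt y.1 τ y.2 = S.U (nbr y).1 τ (nbr y).2.node
  Q_ext : ∀ τ ∈ Icc 0 T, ∀ y, S.QExt y.1 τ y.2 = S.Q (nbr y).1 τ (nbr y).2.node

/-- The discrete entropy `⟨I_N(s), J⟩_N` of an element. -/
def elementEntropy (gas : Gas) (ω : Fin (N + 1) → ℝ) (S : Fields K N) (α : Fin K) (τ : ℝ) : ℝ :=
  volInt ω (fun n => entropy gas (S.U α τ n) * S.J α τ n)

/-- The total discrete entropy. -/
def totalEntropy (gas : Gas) (ω : Fin (N + 1) → ℝ) (S : Fields K N) (τ : ℝ) : ℝ :=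
  ∑ α, S.elementEntropy gas ω α τ

/-- The surface terms that bound the growth of the discrete entropy of an element. -/
def entropySurfaceTerms (gas : Gas) (ξ ω : Fin (N + 1) → ℝ) (Gs : SurfaceFlux) (S : Fields K N)
    (α : Fin K) (τ : ℝ) : ℝ :=
  -surfInt ω (fun x => S.W gas α τ x.node ⬝ᵥ S.fluxNormalStar ξ Gs α τ x
      - density (S.U α τ x.node) * (S.fluidNormal ξ α τ x - S.gridNormalStar ξ α τ x))
    + surfInt ω (fun x =>
        S.W gas α τ x.node ⬝ᵥ (S.viscNormalAvg ξ gas α τ x - S.viscNormal ξ gas α τ x))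
    + surfInt ω (fun x => S.WAvg gas α τ x ⬝ᵥ S.viscNormal ξ gas α τ x)

end Fields

end ALEDG

end

/-! The proof is the continuous entropy argument carried out with quadrature. Since `W` is the
gradient of `s` and `W ⬝ U - s = ρ`, the derivative of `s J` is `W ⬝ ∂(J U) - ρ ∂J` at each node.
Hence the entropy balance results from testing the balance law with `W`, testing the geometric
conservation law with `ρ`, and subtracting.

The advective volume terms collapse to the boundary (`IsLGL.volInt_twoPoint`). Symmetric two-point
parts do so by summation by parts (`IsLGL.volInt_sbp`). Tadmor's condition turns the antisymmetric
part into differences of the potential `ρ u`, and these leave no volume term because the discrete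
divergence of the contravariant vectors vanishes (`sum_partialDeriv_contravariant`).

In the viscous terms, summation by parts and the gradient equation tested with the viscous flux
itself produce `-⟨J Q, B Q⟩` plus surface terms (`volInt_divVisc`). This dissipation has a sign
since the viscous block matrix is positive semidefinite, `J > 0` and the weights are nonnegative.
Dropping it is the only inequality in (a).

For (b) the surface terms are added in pairs across interfaces. The BR1 terms cancel by the product
rule for jumps and averages, and the advective terms leave the defect in the surface stability
condition, scaled by `ŝ ≥ 0`. -/

namespace ALEDG

variable {N : ℕ} {ξ ω : Fin (N + 1) → ℝ}

/-! ### The Legendre-Gauss-Lobatto rule -/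

open Polynomial in
/-- The quadrature weights are nonnegative. -/
theorem IsLGL.weight_nonneg (h : IsLGL N ξ ω) (i : Fin (N + 1)) : 0 ≤ ω i := by
  have hN : N ≠ 0 := by
    rintro rfl
    have h1 := h.left
    have h2 := h.right
    simp only [Fin.last_zero] at h2
    linarith
  have h0l : (0 : Fin (N + 1)) ≠ Fin.last N := by
    intro h'
    exact hN (by simpa using (congrArg Fin.val h').symm)
  have hmem : ∀ j, -1 ≤ ξ j ∧ ξ j ≤ 1 := fun j =>
    ⟨h.left ▸ h.strictMono.monotone (Fin.zero_le j),
      h.right ▸ h.strictMono.monotone (Fin.le_last j)⟩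
  -- The test polynomial `p` vanishes at every node except `ξ i` and is nonnegative on `[-1, 1]`.
  -- Interior nodes need squared factors, but end points need only linear ones because `1 - x` and
  -- `x + 1` do not change sign there. This keeps the degree within `2 * N - 1`, with equality when
  -- `i` is an end point.
  let S : Finset (Fin (N + 1)) := ((Finset.univ.erase 0).erase (Fin.last N)).erase i
  let e : ℕ := if i = Fin.last N then 0 else 1
  let f : ℕ := if i = 0 then 0 else 1
  let p : ℝ[X] := (C 1 - X) ^ e * (X + C 1) ^ f * ∏ j ∈ S, (X - C (ξ j)) ^ 2
  have hp : ∀ x, p.eval x = (1 - x) ^ e * (x + 1) ^ f * ∏ j ∈ S, (x - ξ j) ^ 2 := by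
    intro x
    simp [p, eval_prod]
  have hcard : ((Finset.univ.erase (0 : Fin (N + 1))).erase (Fin.last N)).card = N - 1 := by
    rw [Finset.card_erase_of_mem (by simp [h0l.symm]), Finset.card_erase_of_mem (by simp)]
    simp
  have hdeg : p.natDegree ≤ 2 * N - 1 := by
    have h1 : ((C 1 - X : ℝ[X]) ^ e).natDegree ≤ e :=
      (natDegree_pow_le.trans (Nat.mul_le_mul_left e (m := 1) (by compute_degree))).trans (by simp)
    have h2 : ((X + C 1 : ℝ[X]) ^ f).natDegree ≤ f :=
      (natDegree_pow_le.trans (Nat.mul_le_mul_left f (m := 1) (by compute_degree))).trans (by simp)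
    have h3 : (∏ j ∈ S, (X - C (ξ j)) ^ 2).natDegree ≤ S.card * 2 := by
      refine (natDegree_prod_le _ _).trans ?_
      rw [← smul_eq_mul]
      refine Finset.sum_le_card_nsmul _ _ _ fun j _ => ?_
      compute_degree
    have h4 : p.natDegree ≤ e + f + S.card * 2 :=
      natDegree_mul_le_of_le (natDegree_mul_le_of_le h1 h2) h3
    refine h4.trans ?_
    by_cases hi0 : i = 0
    · have hil : i ≠ Fin.last N := hi0 ▸ h0l
      have : S.card = N - 1 := by
        rw [← hcard]
        exact congrArg _ (Finset.erase_eq_of_notMem (by simp [hi0]))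
      simp only [e, f, hi0, h0l, if_true, if_false, this]
      omega
    · by_cases hil : i = Fin.last N
      · have : S.card = N - 1 := by
          rw [← hcard]
          exact congrArg _ (Finset.erase_eq_of_notMem (by simp [hil]))
        simp only [e, f, hil, h0l.symm, if_true, if_false, this]
        omega
      · have : S.card = N - 1 - 1 := by
          rw [← hcard]
          exact Finset.card_erase_of_mem (by simp [hi0, hil])
        -- An interior node exists, so `N ≥ 2` and the truncated subtraction `N - 1 - 1` is the true
        -- one.
        have hc : 0 < ((Finset.univ.erase (0 : Fin (N + 1))).erase (Fin.last N)).card :=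
          Finset.card_pos.2 ⟨i, by simp [hi0, hil]⟩
        simp only [e, f, hil, hi0, if_false, this]
        omega
  have hnonneg : ∀ x ∈ Icc (-1 : ℝ) 1, 0 ≤ p.eval x := by
    intro x hx
    rw [hp]
    have := hx.1
    have := hx.2
    exact mul_nonneg (mul_nonneg (pow_nonneg (by linarith) _) (pow_nonneg (by linarith) _))
      (Finset.prod_nonneg fun _ _ => sq_nonneg _)
  have hpos : 0 < p.eval (ξ i) := by
    rw [hp]
    refine mul_pos (mul_pos ?_ ?_) ?_
    · by_cases hil : i = Fin.last N
      · simp [e, hil]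
      · have := h.strictMono (lt_of_le_of_ne (Fin.le_last i) hil)
        rw [h.right] at this
        exact pow_pos (by linarith) _
    · by_cases hi0 : i = 0
      · simp [f, hi0]
      · have := h.strictMono (Fin.pos_of_ne_zero hi0)
        rw [h.left] at this
        exact pow_pos (by linarith) _
    · refine Finset.prod_pos fun j hj => ?_
      have hji : j ≠ i := by
        simp only [S, Finset.mem_erase] at hj
        exact hj.1
      exact sq_pos_of_ne_zero (sub_ne_zero.2 (h.strictMono.injective.ne hji.symm))
  have hzero : ∀ j, j ≠ i → p.eval (ξ j) = 0 := by
    intro j hj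
    rw [hp]
    by_cases hj0 : j = 0
    · have : i ≠ 0 := fun h' => hj (hj0.trans h'.symm)
      simp [hj0, h.left, f, this]
    · by_cases hjl : j = Fin.last N
      · have : i ≠ Fin.last N := fun h' => hj (hjl.trans h'.symm)
        simp [hjl, h.right, e, this]
      · have : j ∈ S := by simp [S, hj0, hjl, hj]
        rw [Finset.prod_eq_zero this (by simp), mul_zero]
  have hint := h.exact_of_natDegree_le p hdeg
  rw [Finset.sum_eq_single i (fun j _ hj => by rw [hzero j hj, mul_zero]) (by simp)] at hint
  have : 0 ≤ ω i * p.eval (ξ i) := by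
    rw [← hint]
    exact intervalIntegral.integral_nonneg (by norm_num) hnonneg
  exact nonneg_of_mul_nonneg_left this hpos

theorem IsLGL.basis_eval (h : IsLGL N ξ ω) (i j : Fin (N + 1)) :
    (Lagrange.basis Finset.univ ξ i).eval (ξ j) = if i = j then 1 else 0 := by
  split_ifs with hij
  · subst hij
    exact Lagrange.eval_basis_self h.strictMono.injective.injOn (Finset.mem_univ _)
  · exact Lagrange.eval_basis_of_ne hij (Finset.mem_univ _)

open Polynomial in
/-- The summation by parts property of the derivative matrix. -/
theorem IsLGL.sbp (h : IsLGL N ξ ω) (i m : Fin (N + 1)) :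
    ω i * derivMatrix ξ i m + ω m * derivMatrix ξ m i
      = if i = m then (if i = Fin.last N then 1 else 0) - (if i = 0 then 1 else 0) else 0 := by
  let li := Lagrange.basis Finset.univ ξ i
  let lm := Lagrange.basis Finset.univ ξ m
  have hdeg : ∀ k, (Lagrange.basis Finset.univ ξ k).natDegree ≤ N := by
    intro k
    rw [natDegree_le_iff_degree_le,
      Lagrange.degree_basis h.strictMono.injective.injOn (Finset.mem_univ k)]
    simp
  -- The derivative of a product of two basis polynomials is within the degree of exactness, so
  -- quadrature and the fundamental theorem of calculus give the same value.
  have hd : (derivative (li * lm)).natDegree ≤ 2 * N - 1 := by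
    refine (natDegree_derivative_le _).trans ?_
    have := natDegree_mul_le_of_le (hdeg i) (hdeg m)
    simp only [li, lm]
    omega
  have hq := h.exact_of_natDegree_le _ hd
  rw [intervalIntegral.integral_eq_sub_of_hasDerivAt (fun x _ => (li * lm).hasDerivAt x)
    ((derivative (li * lm)).continuous.intervalIntegrable _ _)] at hq
  have hs : ∑ j, ω j * (derivative (li * lm)).eval (ξ j)
      = ω i * derivMatrix ξ i m + ω m * derivMatrix ξ m i := by
    simp only [derivative_mul, eval_add, eval_mul, mul_add, Finset.sum_add_distrib, li, lm,
      h.basis_eval]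
    simp only [mul_ite, mul_one, mul_zero, ite_mul, one_mul, zero_mul, Finset.sum_ite_eq,
      Finset.mem_univ, if_true, derivMatrix]
    ring
  have hb : (li * lm).eval 1 - (li * lm).eval (-1)
      = (li * lm).eval (ξ (Fin.last N)) - (li * lm).eval (ξ 0) := by rw [h.right, h.left]
  rw [← hs, ← hq, hb]
  have hk : ∀ k, (li * lm).eval (ξ k) = if i = m then (if i = k then 1 else 0) else 0 := by
    intro k
    simp only [eval_mul, li, lm, h.basis_eval]
    split_ifs <;> simp_all
  rw [hk, hk]
  split_ifs <;> simp

/-- The derivative matrix annihilates constants. -/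
theorem IsLGL.sum_derivMatrix (h : IsLGL N ξ ω) (i : Fin (N + 1)) :
    ∑ m, derivMatrix ξ i m = 0 := by
  simp only [derivMatrix]
  rw [← Polynomial.eval_finsetSum, ← Polynomial.derivative_sum,
    Lagrange.sum_basis h.strictMono.injective.injOn Finset.univ_nonempty]
  simp

/-! ### Discrete integrals -/

theorem volInt_add (f g : Node N → ℝ) :
    volInt ω (fun n => f n + g n) = volInt ω f + volInt ω g := by
  simp [volInt, mul_add, Finset.sum_add_distrib]

theorem volInt_sub (f g : Node N → ℝ) :
    volInt ω (fun n => f n - g n) = volInt ω f - volInt ω g := by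
  simp [volInt, mul_sub, Finset.sum_sub_distrib]

theorem volInt_sum {ι : Type*} (s : Finset ι) (f : ι → Node N → ℝ) :
    volInt ω (fun n => ∑ i ∈ s, f i n) = ∑ i ∈ s, volInt ω (f i) := by
  simp only [volInt, Finset.mul_sum]
  exact Finset.sum_comm

theorem volInt_const_mul (c : ℝ) (f : Node N → ℝ) :
    volInt ω (fun n => c * f n) = c * volInt ω f := by
  simp only [volInt, Finset.mul_sum]
  exact Finset.sum_congr rfl fun _ _ => by ring

theorem volInt_nonneg (hω : ∀ i, 0 ≤ ω i) {f : Node N → ℝ} (hf : ∀ n, 0 ≤ f n) :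
    0 ≤ volInt ω f :=
  Finset.sum_nonneg fun n _ => mul_nonneg (Finset.prod_nonneg fun _ _ => hω _) (hf n)

theorem surfInt_add (f g : FaceNode N → ℝ) :
    surfInt ω (fun x => f x + g x) = surfInt ω f + surfInt ω g := by
  simp [surfInt, mul_add, Finset.sum_add_distrib]

theorem surfInt_sub (f g : FaceNode N → ℝ) :
    surfInt ω (fun x => f x - g x) = surfInt ω f - surfInt ω g := by
  simp [surfInt, mul_sub, Finset.sum_sub_distrib]

theorem surfInt_neg (f : FaceNode N → ℝ) :
    surfInt ω (fun x => -f x) = -surfInt ω f := by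
  simp [surfInt]

theorem surfInt_sum {ι : Type*} (s : Finset ι) (f : ι → FaceNode N → ℝ) :
    surfInt ω (fun x => ∑ i ∈ s, f i x) = ∑ i ∈ s, surfInt ω (f i) := by
  simp only [surfInt, Finset.mul_sum]
  exact Finset.sum_comm

/-! ### Summation by parts on the cube -/

/-- Only the two faces orthogonal to direction `d` carry a nonzero component of the normal, with
opposite signs. A node on an edge also lies on other faces, but those entries are multiplied by
zero. -/
theorem surfInt_refNormal (d : Fin 3) (g : Node N → ℝ) :
    surfInt ω (fun x => refNormal x d * g x.node)
      = ∑ n : Node N, (∏ e ∈ Finset.univ.erase d, ω (n e)) *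
          (((if n d = Fin.last N then 1 else 0) - (if n d = 0 then 1 else 0)) * g n) := by
  let F : Face × Node N → ℝ := fun y => (∏ e ∈ Finset.univ.erase y.1.1, ω (y.2 e)) *
    ((if d = y.1.1 then (if y.1.2 then 1 else -1) else 0) * g y.2)
  have h1 : surfInt ω (fun x => refNormal x d * g x.node)
      = ∑ y : Face × Node N, if y.2 y.1.1 = endIndex N y.1.2 then F y else 0 := by
    rw [← Finset.sum_filter]
    exact (Finset.sum_subtype (Finset.univ.filter
      fun y : Face × Node N => y.2 y.1.1 = endIndex N y.1.2) (by simp) F).symm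
  rw [h1, Fintype.sum_prod_type, Finset.sum_comm]
  refine Finset.sum_congr rfl fun n _ => ?_
  rw [Fintype.sum_prod_type, Finset.sum_eq_single d]
  · simp only [Fintype.sum_bool, F, endIndex]
    simp only [if_true, Bool.false_eq_true, if_false]
    split_ifs <;> ring
  · intro e _ he
    simp [F, he.symm]
  · simp

/-- Summation by parts in one direction for two-point functions. -/
theorem IsLGL.volInt_sbp (h : IsLGL N ξ ω) (d : Fin 3) (H : Node N → Node N → ℝ) :
    volInt ω (fun n => ∑ m, derivMatrix ξ (n d) m *
        (H n (Function.update n d m) + H (Function.update n d m) n))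
      = surfInt ω (fun x => refNormal x d * H x.node x.node) := by
  have hw : ∀ n : Node N, ∏ e, ω (n e) = ω (n d) * ∏ e ∈ Finset.univ.erase d, ω (n e) :=
    fun n => (Finset.mul_prod_erase _ _ (Finset.mem_univ d)).symm
  have hwu : ∀ (n : Node N) (m), ∏ e ∈ Finset.univ.erase d, ω (Function.update n d m e)
      = ∏ e ∈ Finset.univ.erase d, ω (n e) := fun n m =>
    Finset.prod_congr rfl fun e he => by
      rw [Function.update_of_ne (Finset.ne_of_mem_erase he)]
  -- Exchanging the two nodes of a pair on a grid line moves the second summand onto the same value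
  -- of `H` as the first, where the coefficients combine to `ω i * D i m + ω m * D m i`. By `h.sbp`
  -- only the diagonal at the end points survives.
  let σ : Node N × Fin (N + 1) → Node N × Fin (N + 1) :=
    fun y => (Function.update y.1 d y.2, y.1 d)
  have hσ : Function.Involutive σ := fun y => by simp [σ]
  have h2 : ∑ y : Node N × Fin (N + 1), (∏ e, ω (y.1 e)) *
        (derivMatrix ξ (y.1 d) y.2 * H (Function.update y.1 d y.2) y.1)
      = ∑ y : Node N × Fin (N + 1), (∏ e ∈ Finset.univ.erase d, ω (y.1 e)) *
        (ω y.2 * derivMatrix ξ y.2 (y.1 d) * H y.1 (Function.update y.1 d y.2)) := by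
    rw [← Equiv.sum_comp hσ.toPerm]
    refine Finset.sum_congr rfl fun y _ => ?_
    simp only [Function.Involutive.coe_toPerm, σ, hw, hwu, Function.update_self,
      Function.update_idem, Function.update_eq_self]
    ring
  rw [surfInt_refNormal d fun n => H n n]
  simp only [volInt, mul_add, Finset.sum_add_distrib, Finset.mul_sum]
  rw [← Fintype.sum_prod_type', ← Fintype.sum_prod_type', h2, Fintype.sum_prod_type,
    Fintype.sum_prod_type, ← Finset.sum_add_distrib]
  refine Finset.sum_congr rfl fun n _ => ?_
  rw [← Finset.sum_add_distrib]
  have : ∀ m, (∏ e, ω (n e)) * (derivMatrix ξ (n d) m * H n (Function.update n d m))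
      + (∏ e ∈ Finset.univ.erase d, ω (n e)) *
        (ω m * derivMatrix ξ m (n d) * H n (Function.update n d m))
      = if n d = m then (∏ e ∈ Finset.univ.erase d, ω (n e)) *
          (((if n d = Fin.last N then 1 else 0) - (if n d = 0 then 1 else 0)) *
            H n (Function.update n d m)) else 0 := by
    intro m
    rw [hw]
    have := h.sbp (n d) m
    split_ifs at this ⊢ <;> linear_combination
      (∏ e ∈ Finset.univ.erase d, ω (n e)) * H n (Function.update n d m) * this
  simp only [this, Finset.sum_ite_eq, Finset.mem_univ, if_true, Function.update_eq_self]

/-- Summation by parts for the partial derivatives of two grid functions. -/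
theorem IsLGL.volInt_partialDeriv_mul (h : IsLGL N ξ ω) (d : Fin 3) (f g : Node N → ℝ) :
    volInt ω (fun n => partialDeriv ξ d f n * g n)
      = surfInt ω (fun x => refNormal x d * (f x.node * g x.node))
        - volInt ω (fun n => f n * partialDeriv ξ d g n) := by
  rw [← h.volInt_sbp d fun n n' => f n * g n', ← volInt_sub]
  congr 1
  ext n
  simp only [partialDeriv, Finset.sum_mul, Finset.mul_sum, ← Finset.sum_sub_distrib]
  exact Finset.sum_congr rfl fun m _ => by ring

/-- The split form of a product with a two-point average. -/
theorem IsLGL.volInt_avg_mul_sub (h : IsLGL N ξ ω) (d : Fin 3) (a f : Node N → ℝ) :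
    volInt ω (fun n => ∑ m, derivMatrix ξ (n d) m *
        (1 / 2 * (a n + a (Function.update n d m)) * (f n - f (Function.update n d m))))
      = volInt ω (fun n => f n * partialDeriv ξ d a n)
        - surfInt ω (fun x => refNormal x d * (a x.node * f x.node)) := by
  -- Both choices of two-point function have the diagonal `a * f`, so each contributes half of the
  -- boundary term.
  have h1 := h.volInt_sbp d fun n n' => a n * f n'
  have h2 := h.volInt_sbp d fun n _ => a n * f n
  have h3 : ∀ n, ∑ m, derivMatrix ξ (n d) m *
        (1 / 2 * (a n + a (Function.update n d m)) * (f n - f (Function.update n d m)))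
      = f n * partialDeriv ξ d a n - (1 / 2 * ∑ m, derivMatrix ξ (n d) m *
          (a n * f (Function.update n d m) + a (Function.update n d m) * f n)
        + 1 / 2 * ∑ m, derivMatrix ξ (n d) m *
          (a n * f n + a (Function.update n d m) * f (Function.update n d m))) := by
    intro n
    -- The rows of the derivative matrix sum to zero, so a multiple of `a n * f n` may be added
    -- freely to complete the splitting.
    have h0 : ∑ m, derivMatrix ξ (n d) m * (a n * f n) = 0 := by
      rw [← Finset.sum_mul, h.sum_derivMatrix, zero_mul]
    rw [← add_zero (_ - _), ← h0, partialDeriv]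
    simp only [Finset.mul_sum, ← Finset.sum_add_distrib, ← Finset.sum_sub_distrib]
    exact Finset.sum_congr rfl fun m _ => by ring
  simp only [h3, volInt_sub, volInt_add, volInt_const_mul, h1, h2]
  ring

/-! ### Commuting discrete derivatives and the metric identities -/

theorem partialDeriv_sub (d : Fin 3) (f g : Node N → ℝ) (n : Node N) :
    partialDeriv ξ d (fun p => f p - g p) n = partialDeriv ξ d f n - partialDeriv ξ d g n := by
  simp [partialDeriv, mul_sub, Finset.sum_sub_distrib]

theorem partialDeriv_neg (d : Fin 3) (f : Node N → ℝ) (n : Node N) :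
    partialDeriv ξ d (fun p => -f p) n = -partialDeriv ξ d f n := by
  simp [partialDeriv]

theorem partialDeriv_comm (d e : Fin 3) (f : Node N → ℝ) (n : Node N) :
    partialDeriv ξ d (partialDeriv ξ e f) n = partialDeriv ξ e (partialDeriv ξ d f) n := by
  rcases eq_or_ne d e with rfl | hde
  · rfl
  simp only [partialDeriv, Finset.mul_sum]
  rw [Finset.sum_comm]
  refine Finset.sum_congr rfl fun k _ => Finset.sum_congr rfl fun m _ => ?_
  rw [Function.update_of_ne hde.symm, Function.update_of_ne hde, Function.update_comm hde]
  ring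

/-- The discrete metric identities. -/
theorem sum_partialDeriv_contravariant (χ : Node N → Vec) (b : Fin 3) (n : Node N) :
    ∑ d, partialDeriv ξ d (contravariant ξ χ d b) n = 0 := by
  have h : ∀ d, partialDeriv ξ d (contravariant ξ χ d b) n
      = -(partialDeriv ξ d (partialDeriv ξ (d + 1)
          (fun p => χ p (b + 2) * partialDeriv ξ (d + 2) (fun r => χ r (b + 1)) p)) n
        - partialDeriv ξ d (partialDeriv ξ (d + 2)
          (fun p => χ p (b + 2) * partialDeriv ξ (d + 1) (fun r => χ r (b + 1)) p)) n) := by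
    intro d
    rw [← partialDeriv_sub, ← partialDeriv_neg]
    rfl
  simp only [h, Fin.sum_univ_three]
  have e1 : (0 : Fin 3) + 1 = 1 := rfl
  have e2 : (0 : Fin 3) + 2 = 2 := rfl
  have e3 : (1 : Fin 3) + 1 = 2 := rfl
  have e4 : (1 : Fin 3) + 2 = 0 := rfl
  have e5 : (2 : Fin 3) + 1 = 0 := rfl
  have e6 : (2 : Fin 3) + 2 = 1 := rfl
  simp only [e1, e2, e3, e4, e5, e6]
  -- A discrete divergence of a discrete curl: the six mixed second derivatives cancel in pairs.
  rw [partialDeriv_comm 1 0, partialDeriv_comm 2 0, partialDeriv_comm 2 1]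
  ring

/-! ### Normals -/

theorem surfElem_nonneg (χ : Node N → Vec) (x : FaceNode N) : 0 ≤ surfElem ξ χ x :=
  Real.sqrt_nonneg _

/-- This needs no nondegeneracy: where `ŝ = 0` the scaled normal has length zero and both sides
vanish. All normal components thereby become linear in the scaled normal. -/
theorem surfElem_mul_unitNormal (χ : Node N → Vec) (x : FaceNode N) (b : Fin 3) :
    surfElem ξ χ x * unitNormal ξ χ x b = scaledNormal ξ χ x b := by
  rcases eq_or_ne (surfElem ξ χ x) 0 with h | h
  · rw [h, zero_mul]
    have hs : ∑ b, scaledNormal ξ χ x b ^ 2 = 0 :=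
      (Real.sqrt_eq_zero (Finset.sum_nonneg fun _ _ => sq_nonneg _)).1 h
    have := (Finset.sum_eq_zero_iff_of_nonneg fun _ _ => sq_nonneg _).1 hs b (Finset.mem_univ b)
    exact (pow_eq_zero_iff two_ne_zero |>.1 this).symm
  · rw [unitNormal, ← mul_assoc, mul_one_div_cancel h, one_mul]

theorem normalVec_eq (χ : Node N → Vec) (x : FaceNode N) (v : Vec) :
    normalVec ξ χ x v = ∑ b, scaledNormal ξ χ x b * v b := by
  simp only [normalVec, Finset.mul_sum, ← mul_assoc, surfElem_mul_unitNormal]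

theorem normalBlock_eq (χ : Node N → Vec) (x : FaceNode N) (f : Block) (a : Fin 5) :
    normalBlock ξ χ x f a = ∑ b, scaledNormal ξ χ x b * f b a := by
  simp only [normalBlock, Finset.mul_sum, ← mul_assoc, surfElem_mul_unitNormal]

theorem dotProduct_normalBlock (χ : Node N → Vec) (x : FaceNode N) (w : State) (f : Block) :
    w ⬝ᵥ normalBlock ξ χ x f = ∑ b, scaledNormal ξ χ x b * (w ⬝ᵥ f b) := by
  simp only [dotProduct, normalBlock_eq, Finset.mul_sum]
  rw [Finset.sum_comm]
  exact Finset.sum_congr rfl fun _ _ => Finset.sum_congr rfl fun _ _ => by ring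

/-- The normal component of a block vector is that of its contravariant components. -/
theorem sum_refNormal_smul_contraBlock (χ : Node N → Vec) (x : FaceNode N) (f : Block) :
    ∑ d, refNormal x d • contraBlock ξ χ x.node f d = normalBlock ξ χ x f := by
  ext a
  simp only [Finset.sum_apply, Pi.smul_apply, smul_eq_mul, normalBlock_eq, contraBlock,
    scaledNormal, Finset.mul_sum, Finset.sum_mul]
  rw [Finset.sum_comm]
  exact Finset.sum_congr rfl fun _ _ => Finset.sum_congr rfl fun _ _ => by ring

end ALEDG

namespace ALEDG

/-! ### Entropy variables and viscous fluxes -/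

/-- Here `-w 4` is `1 / (R T)`; its sign makes the viscous terms dissipative. -/
theorem Admissible.entropyVars_four_neg {gas : Gas} {U : State} (h : Admissible gas U) :
    entropyVars gas U 4 < 0 := by
  have := div_pos h.1 h.2
  simpa [entropyVars] using this

/-- The entropy variables and the entropy are related by `wᵀ u - s = ρ`. -/
theorem Admissible.entropyVars_dotProduct {gas : Gas} {U : State} (h : Admissible gas U) :
    entropyVars gas U ⬝ᵥ U - entropy gas U = density U := by
  have hρ : U 0 ≠ 0 := h.1.ne'
  have hp : pressure gas U ≠ 0 := h.2.ne'
  have hγ : gas.γ - 1 ≠ 0 := (sub_pos.2 gas.one_lt_γ).ne'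
  have hE : U 4 = pressure gas U / (gas.γ - 1) + 1 / 2 * density U * ∑ i, velocity U i ^ 2 := by
    rw [pressure]
    field_simp
    ring
  have hm : ∀ i, U (mom i) = U 0 * velocity U i := fun i => by
    rw [velocity]
    field_simp
  have h1 : U 1 = U 0 * velocity U 0 := hm 0
  have h2 : U 2 = U 0 * velocity U 1 := hm 1
  have h3 : U 3 = U 0 * velocity U 2 := hm 2
  simp only [dotProduct, Fin.sum_univ_five, Fin.sum_univ_three, entropyVars, entropy, density]
    at hE ⊢
  rw [h1, h2, h3, hE]
  -- The logarithm enters linearly and cancels, so what remains is a rational identity in the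
  -- primitive variables.
  generalize velocity U = u at *
  generalize pressure gas U = p at *
  generalize thermoEntropy gas U = s at *
  simp
  field_simp
  ring

/-- The chain rule for the mathematical entropy, whose gradient are the entropy variables. -/
theorem Admissible.hasDerivWithinAt_entropy {gas : Gas} {U : ℝ → State} {V : State} {s : Set ℝ}
    {x : ℝ} (h : Admissible gas (U x)) (hU : HasDerivWithinAt U V s x) :
    HasDerivWithinAt (fun t => entropy gas (U t)) (entropyVars gas (U x) ⬝ᵥ V) s x := by
  have hρ : U x 0 ≠ 0 := h.1.ne'
  have hp : pressure gas (U x) ≠ 0 := h.2.ne'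
  have hγ : gas.γ - 1 ≠ 0 := (sub_pos.2 gas.one_lt_γ).ne'
  have hc : ∀ a, HasDerivWithinAt (fun t => U t a) (V a) s x := hasDerivWithinAt_pi.1 hU
  have hu : ∀ i, HasDerivWithinAt (fun t => velocity (U t) i)
      ((V (mom i) * U x 0 - U x (mom i) * V 0) / U x 0 ^ 2) s x :=
    fun i => (hc (mom i)).fun_div (hc 0) hρ
  have hu2 := HasDerivWithinAt.fun_sum (u := Finset.univ) fun i _ => (hu i).fun_pow 2
  have hP : HasDerivWithinAt (fun t => pressure gas (U t)) _ s x :=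
    ((hc 4).fun_sub (((hc 0).const_mul (1 / 2)).fun_mul hu2)).const_mul (gas.γ - 1)
  have hr : HasDerivWithinAt (fun t => density (U t) ^ (-gas.γ)) _ s x :=
    (hc 0).rpow_const (p := -gas.γ) (Or.inl hρ)
  have hpr : pressure gas (U x) * density (U x) ^ (-gas.γ) ≠ 0 :=
    (mul_pos h.2 (Real.rpow_pos_of_pos h.1 _)).ne'
  have hl : HasDerivWithinAt (fun t => thermoEntropy gas (U t)) _ s x :=
    (hP.fun_mul hr).log hpr
  have hs : HasDerivWithinAt (fun t => ALEDG.entropy gas (U t)) _ s x :=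
    (((hc 0).fun_mul hl).fun_neg).div_const (gas.γ - 1)
  refine hs.congr_deriv ?_
  have hm : ∀ i, U x (mom i) = U x 0 * velocity (U x) i := fun i => by
    rw [velocity]
    field_simp
  -- With this the power `ρ ^ (-γ)` is a common nonzero factor, which cancels in the logarithmic
  -- derivative.
  have hr1 : U x 0 ^ (-gas.γ - 1) = U x 0 ^ (-gas.γ) / U x 0 := Real.rpow_sub_one hρ _
  have hrp : U x 0 ^ (-gas.γ) ≠ 0 := (Real.rpow_pos_of_pos h.1 _).ne'
  have m0 : mom 0 = 1 := rfl
  have m1 : mom 1 = 2 := rfl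
  have m2 : mom 2 = 3 := rfl
  simp only [dotProduct, Fin.sum_univ_five, Fin.sum_univ_three, entropyVars, density, hr1, hm]
  rw [m0, m1, m2]
  generalize velocity (U x) = u at *
  generalize pressure gas (U x) = p at *
  generalize thermoEntropy gas (U x) = e at *
  generalize U x 0 ^ (-gas.γ) = r at *
  simp
  field_simp
  ring

/-- Dissipation by the viscous stresses. -/
theorem sum_stress_mul_nonneg (gas : Gas) (g : Fin 3 → Vec) :
    0 ≤ ∑ i, ∑ j, stress gas g i j * g i j := by
  -- Only the symmetric part of the gradient contributes. Under Stokes' hypothesis the diagonal part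
  -- is `2 ∑ gᵢᵢ² - 2/3 (∑ gᵢᵢ)²`, which is `2/3` times the sum of squared differences.
  have h : ∑ i, ∑ j, stress gas g i j * g i j
      = gas.μ * ((g 0 1 + g 1 0) ^ 2 + (g 0 2 + g 2 0) ^ 2 + (g 1 2 + g 2 1) ^ 2
        + 2 / 3 * ((g 0 0 - g 1 1) ^ 2 + (g 0 0 - g 2 2) ^ 2 + (g 1 1 - g 2 2) ^ 2)) := by
    simp [Fin.sum_univ_three, stress]
    ring
  rw [h]
  have := gas.μ_pos
  positivity

/-- The viscous block matrix is positive semidefinite. -/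
theorem sum_dotProduct_viscousBlock_nonneg (gas : Gas) {w : State} (hw : w 4 < 0) (Q : Block) :
    0 ≤ ∑ b, Q b ⬝ᵥ viscousBlock gas w Q b := by
  have hw0 : w 4 ≠ 0 := hw.ne
  have hR := gas.R_pos.ne'
  let g : Fin 3 → Vec := fun i => velocityDeriv w (Q i)
  -- The work of the stresses in the energy flux combines with the momentum components, so that
  -- gradients of `w` pair with the stress only through `-w 4` times the velocity gradient.
  have hq : ∀ i j, Q i (mom j) + velocityOfEntropy w j * Q i 4 = -w 4 * g i j := by
    intro i j
    simp only [g, velocityDeriv]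
    field_simp
  have m1 : mom 1 = 2 := rfl
  have m2 : mom 2 = 3 := rfl
  have h : ∑ b, Q b ⬝ᵥ viscousBlock gas w Q b
      = -w 4 * ∑ i, ∑ j, stress gas g i j * g i j
        + ∑ i, gas.κ / gas.R * (Q i 4 / w 4) ^ 2 := by
    rw [Finset.mul_sum, ← Finset.sum_add_distrib]
    refine Finset.sum_congr rfl fun i _ => ?_
    have h0 := hq i 0
    have h1 := hq i 1
    have h2 := hq i 2
    rw [show mom 0 = 1 from rfl] at h0
    rw [m1] at h1
    rw [m2] at h2
    have hT : gas.κ / gas.R * (Q i 4 / w 4) ^ 2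
        = Q i 4 * (gas.κ * temperatureDeriv gas w (Q i)) := by
      rw [temperatureDeriv]
      field_simp
    rw [hT]
    change Q i ⬝ᵥ viscousFlux gas (velocityOfEntropy w) g
      (fun i => temperatureDeriv gas w (Q i)) i = _
    simp only [dotProduct, Fin.sum_univ_five, Fin.sum_univ_three, viscousFlux]
    simp
    linear_combination stress gas g i 0 * h0 + stress gas g i 1 * h1 + stress gas g i 2 * h2
  rw [h]
  have := gas.κ_pos
  have := gas.R_pos
  refine add_nonneg (mul_nonneg (by linarith) (sum_stress_mul_nonneg gas g)) ?_
  exact Finset.sum_nonneg fun i _ => by positivity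

end ALEDG

namespace ALEDG

variable {N K : ℕ} {gas : Gas} {ξ ω : Fin (N + 1) → ℝ} {T : ℝ}
  {Gv : VolumeFlux} {Gs : SurfaceFlux} {S : Fields K N}

theorem dotProduct_avg {ι : Type*} [Fintype ι] (w f g : ι → ℝ) :
    w ⬝ᵥ avg f g = 1 / 2 * (w ⬝ᵥ f + w ⬝ᵥ g) := by
  simp only [dotProduct, avg, Finset.mul_sum, ← Finset.sum_add_distrib]
  exact Finset.sum_congr rfl fun _ _ => by ring

theorem avg_dotProduct {ι : Type*} [Fintype ι] (f g w : ι → ℝ) :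
    avg f g ⬝ᵥ w = 1 / 2 * (f ⬝ᵥ w + g ⬝ᵥ w) := by
  rw [dotProduct_comm, dotProduct_avg, dotProduct_comm f, dotProduct_comm g]

/-! ### The volume terms -/

/-- The contribution of the advective volume terms to the entropy balance reduces to the boundary,
for two-point fluxes `g`, `v` that satisfy Tadmor's condition with potential `f`. -/
theorem IsLGL.volInt_twoPoint (h : IsLGL N ξ ω) (χ : Node N → Vec) (g : Node N → Node N → Block)
    (v : Node N → Node N → Vec) (w : Node N → State) (ρ : Node N → ℝ) (f : Node N → Vec)
    (hg : ∀ n d m, g (Function.update n d m) n = g n (Function.update n d m))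
    (hv : ∀ n n', v n' n = v n n')
    (hEC : ∀ n d m i, (w n - w (Function.update n d m)) ⬝ᵥ g n (Function.update n d m) i
      = f n i - f (Function.update n d m) i
        - v n (Function.update n d m) i * (ρ n - ρ (Function.update n d m))) :
    volInt ω (fun n => (fun a => ∑ d, ∑ m, 2 * derivMatrix ξ (n d) m *
          ∑ b, g n (Function.update n d m) b a * (1 / 2 * (contravariant ξ χ d b n
            + contravariant ξ χ d b (Function.update n d m)))) ⬝ᵥ w n)
      + volInt ω (fun n => (∑ d, ∑ m, 2 * derivMatrix ξ (n d) m *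
          ∑ b, v n (Function.update n d m) b * (1 / 2 * (contravariant ξ χ d b n
            + contravariant ξ χ d b (Function.update n d m)))) * ρ n)
      = surfInt ω (fun x => ∑ b, scaledNormal ξ χ x b *
          (w x.node ⬝ᵥ g x.node x.node b + v x.node x.node b * ρ x.node - f x.node b)) := by
  let A : Fin 3 → Fin 3 → Node N → Node N → ℝ := fun d b n n' =>
    1 / 2 * (contravariant ξ χ d b n + contravariant ξ χ d b n')
  -- Writing `2 H(n, n')` as symmetric plus antisymmetric part, the first is treated by
  -- `volInt_sbp`. In the second the metric average `A` is symmetric, so Tadmor's condition leaves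
  -- `A` times the jump of `f`.
  let H : Fin 3 → Node N → Node N → ℝ := fun d n n' =>
    ∑ b, A d b n n' * (w n ⬝ᵥ g n n' b + v n n' b * ρ n)
  have hpoint : ∀ n : Node N, (fun a => ∑ d, ∑ m, 2 * derivMatrix ξ (n d) m *
          ∑ b, g n (Function.update n d m) b a * (1 / 2 * (contravariant ξ χ d b n
            + contravariant ξ χ d b (Function.update n d m)))) ⬝ᵥ w n
      + (∑ d, ∑ m, 2 * derivMatrix ξ (n d) m *
          ∑ b, v n (Function.update n d m) b * (1 / 2 * (contravariant ξ χ d b n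
            + contravariant ξ χ d b (Function.update n d m)))) * ρ n
      = ∑ d, (∑ m, derivMatrix ξ (n d) m *
          (H d n (Function.update n d m) + H d (Function.update n d m) n)
        + ∑ b, ∑ m, derivMatrix ξ (n d) m * (1 / 2 * (contravariant ξ χ d b n
          + contravariant ξ χ d b (Function.update n d m))
            * (f n b - f (Function.update n d m) b))) := by
    intro n
    rw [dotProduct]
    simp only [Finset.sum_mul]
    rw [Finset.sum_comm, ← Finset.sum_add_distrib]
    refine Finset.sum_congr rfl fun d _ => ?_
    rw [Finset.sum_comm, ← Finset.sum_add_distrib,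
      Finset.sum_comm (s := (Finset.univ : Finset (Fin 3))), ← Finset.sum_add_distrib]
    refine Finset.sum_congr rfl fun m _ => ?_
    simp only [H, hg, hv n]
    have hA : ∀ b, A d b (Function.update n d m) n = A d b n (Function.update n d m) :=
      fun b => by simp only [A, add_comm]
    have hsw : ∑ a, 2 * derivMatrix ξ (n d) m * (∑ b, g n (Function.update n d m) b a *
          (1 / 2 * (contravariant ξ χ d b n
            + contravariant ξ χ d b (Function.update n d m)))) * w n a
        = ∑ b, 2 * derivMatrix ξ (n d) m * A d b n (Function.update n d m)
          * (w n ⬝ᵥ g n (Function.update n d m) b) := by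
      simp only [dotProduct, Finset.mul_sum, Finset.sum_mul]
      rw [Finset.sum_comm]
      exact Finset.sum_congr rfl fun _ _ => Finset.sum_congr rfl fun _ _ => by simp only [A]; ring
    rw [hsw]
    simp only [Finset.mul_sum, Finset.sum_mul, ← Finset.sum_add_distrib]
    refine Finset.sum_congr rfl fun b _ => ?_
    have hb := hEC n d m b
    rw [sub_dotProduct] at hb
    rw [hA]
    simp only [A]
    linear_combination derivMatrix ξ (n d) m * (1 / 2 * (contravariant ξ χ d b n
          + contravariant ξ χ d b (Function.update n d m))) * hb
  have hdiag : ∀ d x, H d x x = ∑ b, contravariant ξ χ d b x *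
      (w x ⬝ᵥ g x x b + v x x b * ρ x) := fun d x =>
    Finset.sum_congr rfl fun b _ => by simp only [A]; ring
  -- The volume remainder of the potential, after the split form has moved the derivative onto the
  -- metric terms.
  have hmetric : ∑ d, ∑ b, volInt ω (fun n => f n b * partialDeriv ξ d (contravariant ξ χ d b) n)
      = 0 := by
    rw [Finset.sum_comm]
    refine Finset.sum_eq_zero fun b _ => ?_
    rw [← volInt_sum]
    simp only [← Finset.mul_sum, sum_partialDeriv_contravariant, mul_zero]
    simp [volInt]
  rw [← volInt_add]
  simp only [hpoint]
  rw [volInt_sum]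
  have hd : ∀ d, volInt ω (fun n => ∑ m, derivMatrix ξ (n d) m *
          (H d n (Function.update n d m) + H d (Function.update n d m) n)
        + ∑ b, ∑ m, derivMatrix ξ (n d) m * (1 / 2 * (contravariant ξ χ d b n
          + contravariant ξ χ d b (Function.update n d m))
            * (f n b - f (Function.update n d m) b)))
      = surfInt ω (fun x => refNormal x d * H d x.node x.node)
        + (∑ b, volInt ω (fun n => f n b * partialDeriv ξ d (contravariant ξ χ d b) n)
          - surfInt ω (fun x => ∑ b,
              refNormal x d * (contravariant ξ χ d b x.node * f x.node b))) := by
    intro d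
    rw [volInt_add, h.volInt_sbp, volInt_sum, surfInt_sum, ← Finset.sum_sub_distrib]
    congr 1
    exact Finset.sum_congr rfl fun b _ => h.volInt_avg_mul_sub d _ fun n => f n b
  simp only [hd]
  rw [Finset.sum_add_distrib, Finset.sum_sub_distrib, hmetric, ← surfInt_sum, ← surfInt_sum,
    zero_sub, ← sub_eq_add_neg, ← surfInt_sub]
  congr 1
  ext x
  simp only [hdiag, scaledNormal, Finset.mul_sum, Finset.sum_mul, ← Finset.sum_sub_distrib]
  rw [Finset.sum_comm]
  exact Finset.sum_congr rfl fun _ _ => Finset.sum_congr rfl fun _ _ => by ring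

namespace Fields

/-- The potential is `ρ u`. Symmetry of `Gv` allows the exchange of nodes, and consistency
identifies its diagonal with the interior flux `F - ν U`. -/
theorem volInt_advective (hLGL : IsLGL N ξ ω) (hcons : Gv.Consistent gas)
    (hsymm : Gv.Symmetric gas) (hS : S.SolvesScheme gas ξ ω Gv Gs T)
    (hEC : S.VolumeEntropyConservative gas Gv T) (α : Fin K) {τ : ℝ} (hτ : τ ∈ Icc 0 T) :
    volInt ω (fun n => S.divVolume ξ Gv α τ n ⬝ᵥ S.W gas α τ n)
        + volInt ω (fun n => S.divGrid ξ α τ n * density (S.U α τ n))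
      = surfInt ω (fun x => S.W gas α τ x.node ⬝ᵥ S.fluxNormal ξ gas α τ x
          + density (S.U α τ x.node) * S.gridNormal ξ α τ x
          - density (S.U α τ x.node) * S.fluidNormal ξ α τ x) := by
  have hadm := hS.admissible α τ hτ
  have h := hLGL.volInt_twoPoint (S.χ α τ)
    (fun n n' => Gv (S.ν α τ n) (S.ν α τ n') (S.U α τ n) (S.U α τ n'))
    (fun n n' => avg (S.ν α τ n) (S.ν α τ n')) (S.W gas α τ) (fun n => density (S.U α τ n))
    (fun n i => density (S.U α τ n) * velocity (S.U α τ n) i)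
    (fun n d m => hsymm _ _ _ _ (hadm _) (hadm _))
    (fun n n' => by ext i; simp only [avg, add_comm])
    (hEC α τ hτ)
  refine h.trans ?_
  congr 1
  ext x
  have havg : avg (S.ν α τ x.node) (S.ν α τ x.node) = S.ν α τ x.node := by
    ext i
    simp only [avg]
    ring
  have hG : Gv (S.ν α τ x.node) (S.ν α τ x.node) (S.U α τ x.node) (S.U α τ x.node)
      = fun i a => eulerFlux gas (S.U α τ x.node) i a
        - S.ν α τ x.node i * S.U α τ x.node a := by
    ext i a
    rw [hcons _ _ _ (hadm _), havg]
  simp only [havg, hG, fluxNormal, gridNormal, fluidNormal, dotProduct_normalBlock, normalVec_eq,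
    Finset.mul_sum, ← Finset.sum_add_distrib, ← Finset.sum_sub_distrib]
  exact Finset.sum_congr rfl fun _ _ => by ring

theorem volInt_divVisc (hLGL : IsLGL N ξ ω) (hS : S.SolvesScheme gas ξ ω Gv Gs T)
    (α : Fin K) {τ : ℝ} (hτ : τ ∈ Icc 0 T) :
    volInt ω (fun n => S.divVisc ξ gas α τ n ⬝ᵥ S.W gas α τ n)
      = surfInt ω (fun x => S.WAvg gas α τ x ⬝ᵥ S.viscNormal ξ gas α τ x)
        - volInt ω (fun n => S.J α τ n * ∑ b, S.Q α τ n b ⬝ᵥ S.visc gas α τ n b) := by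
  -- Testing with the viscous flux makes the volume term the dissipation. The one-sided products of
  -- `W` with the flux at the boundary then cancel those from summation by parts, leaving the
  -- average of `W`.
  have hgrad := hS.gradient α τ hτ (S.visc gas α τ)
  simp only [sum_refNormal_smul_contraBlock, smul_dotProduct, smul_eq_mul, ← Finset.mul_sum,
    sub_dotProduct] at hgrad
  have hparts : volInt ω (fun n => S.divVisc ξ gas α τ n ⬝ᵥ S.W gas α τ n)
      = surfInt ω (fun x => S.W gas α τ x.node ⬝ᵥ S.viscNormal ξ gas α τ x)
        - volInt ω (fun n => ∑ d, S.gradW ξ gas α τ n d ⬝ᵥ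
            contraBlock ξ (S.χ α τ) n (S.visc gas α τ n) d) := by
    have h1 : ∀ n, S.divVisc ξ gas α τ n ⬝ᵥ S.W gas α τ n
        = ∑ d, ∑ a, partialDeriv ξ d
            (fun p => contraBlock ξ (S.χ α τ) p (S.visc gas α τ p) d a) n * S.W gas α τ n a := by
      intro n
      simp only [dotProduct, divVisc, Finset.sum_mul]
      exact Finset.sum_comm
    simp only [h1, volInt_sum, hLGL.volInt_partialDeriv_mul, Finset.sum_sub_distrib]
    congr 1
    · simp only [← surfInt_sum]
      congr 1
      ext x
      rw [viscNormal, ← sum_refNormal_smul_contraBlock]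
      simp only [dotProduct, Finset.sum_apply, Pi.smul_apply, smul_eq_mul, Finset.mul_sum]
      rw [Finset.sum_comm]
      exact Finset.sum_congr rfl fun _ _ => Finset.sum_congr rfl fun _ _ => by ring
    · refine Finset.sum_congr rfl fun d _ => ?_
      simp only [dotProduct, ← volInt_sum, gradW]
      congr 1
      ext n
      exact Finset.sum_congr rfl fun _ _ => by ring
  rw [surfInt_sub] at hgrad
  rw [hparts, hgrad]
  simp only [viscNormal]
  ring

/-! ### Time derivatives -/

/-- The scheme gives differentiability of `J` and `J U` only; `U` is recovered on dividing by `J >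
0`. The factor `density` multiplying the derivative of `J` is `W ⬝ U - s`. -/
theorem SolvesScheme.hasDerivWithinAt_entropy (hS : S.SolvesScheme gas ξ ω Gv Gs T)
    (hT : 0 < T) (α : Fin K) {τ : ℝ} (hτ : τ ∈ Icc 0 T) (n : Node N) :
    HasDerivWithinAt (fun t => entropy gas (S.U α t n) * S.J α t n)
      (derivWithin (fun t => S.J α t n • S.U α t n) (Icc 0 T) τ ⬝ᵥ S.W gas α τ n
        - derivWithin (fun t => S.J α t n) (Icc 0 T) τ * density (S.U α τ n)) (Icc 0 T) τ := by
  have hJ := (hS.J_diff α τ hτ n).hasDerivWithinAt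
  have hJU := (hS.JU_diff α τ hτ n).hasDerivWithinAt
  have hJ0 : ∀ t ∈ Icc 0 T, S.J α t n ≠ 0 := fun t ht => (hS.J_pos α t ht n).ne'
  have hUd : DifferentiableWithinAt ℝ (fun t => S.U α t n) (Icc 0 T) τ := by
    refine DifferentiableWithinAt.congr
      (((hS.J_diff α τ hτ n).inv (hJ0 τ hτ)).smul (hS.JU_diff α τ hτ n)) (fun t ht => ?_) ?_
    · exact (inv_smul_smul₀ (hJ0 t ht) _).symm
    · exact (inv_smul_smul₀ (hJ0 τ hτ) _).symm
  have hU := hUd.hasDerivWithinAt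
  have hprod := (hJ.fun_smul hU).derivWithin (uniqueDiffOn_Icc hT τ hτ)
  have hadm := hS.admissible α τ hτ n
  refine ((hadm.hasDerivWithinAt_entropy hU).fun_mul hJ).congr_deriv ?_
  rw [hprod, add_dotProduct, smul_dotProduct, smul_dotProduct, W, smul_eq_mul, smul_eq_mul,
    ← hadm.entropyVars_dotProduct, dotProduct_comm _ (entropyVars gas (S.U α τ n)),
    dotProduct_comm _ (entropyVars gas (S.U α τ n))]
  ring

/-- The entropy balance of an element. -/
theorem SolvesScheme.hasDerivWithinAt_elementEntropy (hLGL : IsLGL N ξ ω)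
    (hcons : Gv.Consistent gas) (hsymm : Gv.Symmetric gas)
    (hS : S.SolvesScheme gas ξ ω Gv Gs T) (hEC : S.VolumeEntropyConservative gas Gv T)
    (hT : 0 < T) (α : Fin K) {τ : ℝ} (hτ : τ ∈ Icc 0 T) :
    HasDerivWithinAt (S.elementEntropy gas ω α)
      (S.entropySurfaceTerms gas ξ ω Gs α τ
        - volInt ω (fun n => S.J α τ n * ∑ b, S.Q α τ n b ⬝ᵥ S.visc gas α τ n b))
      (Icc 0 T) τ := by
  have hder : HasDerivWithinAt (S.elementEntropy gas ω α) _ (Icc 0 T) τ :=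
    HasDerivWithinAt.fun_sum (u := Finset.univ) fun n _ =>
      (hS.hasDerivWithinAt_entropy hT α hτ n).const_mul (∏ d, ω (n d))
  refine hder.congr_deriv ?_
  change volInt ω (fun n => _ - _) = _
  rw [volInt_sub, hS.balance α τ hτ (S.W gas α τ), hS.gcl α τ hτ (fun n => density (S.U α τ n)),
    volInt_divVisc hLGL hS α hτ]
  have hadv := volInt_advective hLGL hcons hsymm hS hEC α hτ
  rw [surfInt_sub, surfInt_add] at hadv
  simp only [entropySurfaceTerms, dotProduct_sub, mul_sub, surfInt_sub]
  -- The interior normal fluxes cancel, so only numerical fluxes and `ρ u` remain at the boundary.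
  linear_combination -hadv

theorem SolvesScheme.dissipation_nonneg (hLGL : IsLGL N ξ ω)
    (hS : S.SolvesScheme gas ξ ω Gv Gs T) (α : Fin K) {τ : ℝ} (hτ : τ ∈ Icc 0 T) :
    0 ≤ volInt ω (fun n => S.J α τ n * ∑ b, S.Q α τ n b ⬝ᵥ S.visc gas α τ n b) :=
  volInt_nonneg hLGL.weight_nonneg fun n => mul_nonneg (hS.J_pos α τ hτ n).le
    (sum_dotProduct_viscousBlock_nonneg gas (hS.admissible α τ hτ n).entropyVars_four_neg _)

/-! ### Interfaces of a periodic mesh -/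

/-- The integrand of `entropySurfaceTerms`. -/
noncomputable def entropySurfaceDensity (gas : Gas) (ξ : Fin (N + 1) → ℝ) (Gs : SurfaceFlux)
    (S : Fields K N) (τ : ℝ) (y : Fin K × FaceNode N) : ℝ :=
  -(S.W gas y.1 τ y.2.node ⬝ᵥ S.fluxNormalStar ξ Gs y.1 τ y.2
      - density (S.U y.1 τ y.2.node) * (S.fluidNormal ξ y.1 τ y.2 - S.gridNormalStar ξ y.1 τ y.2))
    + S.W gas y.1 τ y.2.node ⬝ᵥ (S.viscNormalAvg ξ gas y.1 τ y.2 - S.viscNormal ξ gas y.1 τ y.2)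
    + S.WAvg gas y.1 τ y.2 ⬝ᵥ S.viscNormal ξ gas y.1 τ y.2

theorem sum_entropySurfaceTerms (τ : ℝ) :
    ∑ α, S.entropySurfaceTerms gas ξ ω Gs α τ
      = ∑ y : Fin K × FaceNode N, faceWeight ω y.2 * S.entropySurfaceDensity gas ξ Gs τ y := by
  rw [Fintype.sum_prod_type]
  refine Finset.sum_congr rfl fun α _ => ?_
  rw [entropySurfaceTerms, ← surfInt_neg, ← surfInt_add, ← surfInt_add]
  rfl

variable {nbr : Fin K × FaceNode N → Fin K × FaceNode N}

/-- The two sides of an interface together do not produce entropy. -/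
theorem Periodic.entropySurfaceDensity_add_nonpos (hP : S.Periodic ξ ω T nbr)
    (hadm : ∀ α, ∀ τ ∈ Icc 0 T, ∀ n, Admissible gas (S.U α τ n))
    (hGs : Gs.SingleValued gas) (hES : S.SurfaceEntropyStable gas ξ Gs T) {τ : ℝ}
    (hτ : τ ∈ Icc 0 T) (y : Fin K × FaceNode N) :
    S.entropySurfaceDensity gas ξ Gs τ y + S.entropySurfaceDensity gas ξ Gs τ (nbr y) ≤ 0 := by
  have hn := hP.normal τ hτ y
  have hν := hP.ν_ext τ hτ y
  have hU := hP.U_ext τ hτ y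
  have hQ := hP.Q_ext τ hτ y
  have hν' := hP.ν_ext τ hτ (nbr y)
  have hU' := hP.U_ext τ hτ (nbr y)
  have hQ' := hP.Q_ext τ hτ (nbr y)
  rw [hP.involutive y] at hν' hU' hQ'
  have hs : surfElem ξ (S.χ (nbr y).1 τ) (nbr y).2 = surfElem ξ (S.χ y.1 τ) y.2 := by
    simp only [surfElem, hn, Pi.neg_apply, neg_sq]
  have hu : unitNormal ξ (S.χ (nbr y).1 τ) (nbr y).2 = -unitNormal ξ (S.χ y.1 τ) y.2 := by
    ext b
    simp only [unitNormal, hs, hn, Pi.neg_apply, mul_neg]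
  -- From the partner the normal is reversed and the two states are swapped, which is the situation
  -- of `SingleValued`.
  have hG : S.surfaceFluxAt ξ Gs (nbr y).1 τ (nbr y).2 = S.surfaceFluxAt ξ Gs y.1 τ y.2 := by
    rw [surfaceFluxAt, surfaceFluxAt, hu, hν, hU, hν', hU']
    exact hGs _ _ _ _ _ (hadm _ _ hτ _) (hadm _ _ hτ _)
  have hW : S.WExt gas y.1 τ y.2 = S.W gas (nbr y).1 τ (nbr y).2.node := by
    rw [WExt, W, hU]
  have hW' : S.WExt gas (nbr y).1 τ (nbr y).2 = S.W gas y.1 τ y.2.node := by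
    rw [WExt, W, hU']
  have hB : S.viscExt gas y.1 τ y.2 = S.visc gas (nbr y).1 τ (nbr y).2.node := by
    rw [viscExt, visc, hW, hQ]
  have hB' : S.viscExt gas (nbr y).1 τ (nbr y).2 = S.visc gas y.1 τ y.2.node := by
    rw [viscExt, visc, hW', hQ']
  have hstab := mul_le_mul_of_nonneg_left (hES y.1 τ hτ y.2)
    (surfElem_nonneg (ξ := ξ) (S.χ y.1 τ) y.2)
  simp only [Finset.mul_sum, ← mul_assoc, surfElem_mul_unitNormal] at hstab
  rw [← sub_nonpos, ← Finset.sum_sub_distrib] at hstab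
  -- The sum over both sides equals the scaled defect in the stability condition. The viscous part
  -- vanishes by `⟦W B⟧ = ⦃W⦄ ⟦B⟧ + ⟦W⟧ ⦃B⦄`.
  refine le_of_eq_of_le ?_ hstab
  simp only [entropySurfaceDensity, dotProduct_sub, fluxNormalStar, viscNormal, viscNormalAvg,
    fluidNormal, gridNormalStar, dotProduct_normalBlock, normalVec_eq, hG, hn, Pi.neg_apply,
    WAvg, hW, hW', hB, hB', hU, hν, hν', Finset.mul_sum, ← Finset.sum_add_distrib,
    ← Finset.sum_sub_distrib, ← Finset.sum_neg_distrib]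
  refine Finset.sum_congr rfl fun b _ => ?_
  simp only [avgBlock, dotProduct_avg, avg_dotProduct, sub_dotProduct, avg]
  ring

/-- Reindexing by the involution writes twice the total as a weighted sum over interface pairs, so
no representative of each pair has to be chosen. -/
theorem Periodic.sum_entropySurfaceTerms_nonpos (hLGL : IsLGL N ξ ω)
    (hP : S.Periodic ξ ω T nbr)
    (hadm : ∀ α, ∀ τ ∈ Icc 0 T, ∀ n, Admissible gas (S.U α τ n))
    (hGs : Gs.SingleValued gas) (hES : S.SurfaceEntropyStable gas ξ Gs T) {τ : ℝ}
    (hτ : τ ∈ Icc 0 T) : ∑ α, S.entropySurfaceTerms gas ξ ω Gs α τ ≤ 0 := by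
  rw [sum_entropySurfaceTerms]
  have h1 := Equiv.sum_comp hP.involutive.toPerm
    fun y : Fin K × FaceNode N => faceWeight ω y.2 * S.entropySurfaceDensity gas ξ Gs τ y
  have h2 : ∑ y : Fin K × FaceNode N,
      (faceWeight ω y.2 * S.entropySurfaceDensity gas ξ Gs τ y
        + faceWeight ω (nbr y).2 * S.entropySurfaceDensity gas ξ Gs τ (nbr y)) ≤ 0 := by
    refine Finset.sum_nonpos fun y _ => ?_
    rw [hP.weight y, ← mul_add]
    exact mul_nonpos_of_nonneg_of_nonpos (Finset.prod_nonneg fun _ _ => hLGL.weight_nonneg _)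
      (hP.entropySurfaceDensity_add_nonpos hadm hGs hES hτ y)
  rw [Finset.sum_add_distrib] at h2
  simp only [Function.Involutive.coe_toPerm] at h1
  linarith

end Fields

end ALEDG

/-! ### Entropy inequalities for one element and for the whole mesh -/

theorem mainTheorem2 (gas : ALEDG.Gas) {N K : ℕ} (ξ ω : Fin (N + 1) → ℝ)
    (hLGL : ALEDG.IsLGL N ξ ω) (T : ℝ) (hT : 0 < T)
    (Gv : ALEDG.VolumeFlux) (Gs : ALEDG.SurfaceFlux)
    (hcons : Gv.Consistent gas) (hsymm : Gv.Symmetric gas)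
    (S : ALEDG.Fields K N) (hS : S.SolvesScheme gas ξ ω Gv Gs T)
    (hEC : S.VolumeEntropyConservative gas Gv T) :
    (∀ α, ∀ τ ∈ Icc 0 T,
      DifferentiableWithinAt ℝ (S.elementEntropy gas ω α) (Icc 0 T) τ ∧
      derivWithin (S.elementEntropy gas ω α) (Icc 0 T) τ
        ≤ S.entropySurfaceTerms gas ξ ω Gs α τ) ∧
    (∀ nbr : Fin K × ALEDG.FaceNode N → Fin K × ALEDG.FaceNode N,
      S.Periodic ξ ω T nbr → Gs.SingleValued gas → S.SurfaceEntropyStable gas ξ Gs T →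
        (∀ τ ∈ Icc 0 T,
          DifferentiableWithinAt ℝ (S.totalEntropy gas ω) (Icc 0 T) τ ∧
          derivWithin (S.totalEntropy gas ω) (Icc 0 T) τ ≤ 0) ∧
        AntitoneOn (S.totalEntropy gas ω) (Icc 0 T)) := by
  have helem : ∀ α, ∀ τ ∈ Icc 0 T,
      DifferentiableWithinAt ℝ (S.elementEntropy gas ω α) (Icc 0 T) τ ∧
      derivWithin (S.elementEntropy gas ω α) (Icc 0 T) τ
        ≤ S.entropySurfaceTerms gas ξ ω Gs α τ := by
    intro α τ hτ
    have h := hS.hasDerivWithinAt_elementEntropy hLGL hcons hsymm hEC hT α hτ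
    refine ⟨h.differentiableWithinAt, ?_⟩
    rw [h.derivWithin (uniqueDiffOn_Icc hT τ hτ)]
    exact sub_le_self _ (hS.dissipation_nonneg hLGL α hτ)
  refine ⟨helem, fun nbr hP hGs hES => ?_⟩
  have htot : ∀ τ ∈ Icc 0 T, DifferentiableWithinAt ℝ (S.totalEntropy gas ω) (Icc 0 T) τ ∧
      derivWithin (S.totalEntropy gas ω) (Icc 0 T) τ ≤ 0 := by
    intro τ hτ
    have h : HasDerivWithinAt (S.totalEntropy gas ω) _ (Icc 0 T) τ :=
      HasDerivWithinAt.fun_sum (u := Finset.univ) fun α _ => (helem α τ hτ).1.hasDerivWithinAt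
    refine ⟨h.differentiableWithinAt, ?_⟩
    rw [h.derivWithin (uniqueDiffOn_Icc hT τ hτ)]
    exact (Finset.sum_le_sum fun α _ => (helem α τ hτ).2).trans
      (hP.sum_entropySurfaceTerms_nonpos hLGL hS.admissible hGs hES hτ)
  refine ⟨htot, antitoneOn_of_deriv_nonpos (convex_Icc 0 T)
    (fun τ hτ => (htot τ hτ).1.continuousWithinAt)
    (fun τ hτ => (htot τ (interior_subset hτ)).1.mono interior_subset) fun τ hτ => ?_⟩
  rw [← derivWithin_of_mem_nhds (mem_interior_iff_mem_nhds.1 hτ)]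
  exact (htot τ (interior_subset hτ)).2
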